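/- A perfect secret sharing scheme for a (finite or infinite) graph $G=(V,E)$ is a family of jointly distributed discrete random variables, a secret $\xi$ with Shannon entropy $0<H(\xi)<\infty$ and a share $\xi_v$ for each $v\in V$, such that (i) for every edge $vw$ the pair $(\xi_v,\xi_w)$ determines $\xi$ almost surely, and (ii) for every (possibly infinite) independent set $A\subseteq V$ the secret $\xi$ is statistically independent of the collection $(\xi_v)_{v\in A}$. The (worst case) information ratio of the scheme is $\sup_{v\in V} H(\xi_v)/H(\xi)$ and, if $V$ is finite and nonempty, its average information ratio is $\frac1{|V|}\sum_{v\in V}H(\xi_v)/H(\xi)$. The worst case (respectively, for finite $G$, average) information ratio of $G$ is the infimum of this quantity over all perfect secret sharing schemes for $G$. The average information ratio of an infinite graph is the supremum of the average information ratios of its finite nonempty spanned (induced) subgraphs. Let $L^d$ be the graph with vertex set $\mathbb Z^d$ in which two points are adjacent if and only if they differ in exactly one coordinate, and there by exactly $1$, and let $L^d_k$ be its subgraph spanned by $\{0,1,\dots,k-1\}^d$. Theorem. For every $d\ge 2$ the information ratio of $L^d$ is exactly $d$, both in the worst case and in the average sense: the worst case information ratio of $L^d$ equals $d$, the average information ratio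 of $L^d$ equals $d$, and the average information ratio of $L^d_k$ tends to $d$ as $k\to\infty$. -/

import Mathlib

open MeasureTheory ProbabilityTheory Filter Topology
open scoped ENNReal

noncomputable section

/-- Shannon entropy `∑ₓ -P(X = x) log P(X = x)` of a discrete random variable, possibly `∞`.
The base of the logarithm is irrelevant below, since only quotients of entropies occur. -/
def shannonEntropy {Ω S : Type} [MeasurableSpace Ω] (μ : Measure Ω) (X : Ω → S) : ℝ≥0∞ :=
  ∑' x : S, ENNReal.ofReal (Real.negMulLog (μ.real (X ⁻¹' {x})))

/-- A perfect secret sharing scheme for the graph `G`: jointly distributed discrete random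
variables, the secret and one share for every vertex, such that the two shares at the ends of an
edge determine the secret (almost surely) and the shares of any (possibly infinite) independent
set are jointly independent of the secret. The secret has positive finite entropy, so that the
information ratios make sense. -/
structure SecretSharingScheme {V : Type} (G : SimpleGraph V) where
  /-- the sample space -/
  Ω : Type
  [measurableSpaceΩ : MeasurableSpace Ω]
  /-- the probability measure -/
  μ : Measure Ω
  [isProbabilityMeasure : IsProbabilityMeasure μ]
  /-- the set of values of the secret -/
  Secret : Type
  [countableSecret : Countable Secret]
  [measurableSpaceSecret : MeasurableSpace Secret]
  [discreteSecret : DiscreteMeasurableSpace Secret]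
  /-- the set of values of the share of a vertex -/
  Share : V → Type
  [countableShare : ∀ v, Countable (Share v)]
  [measurableSpaceShare : ∀ v, MeasurableSpace (Share v)]
  [discreteShare : ∀ v, DiscreteMeasurableSpace (Share v)]
  /-- the secret -/
  secret : Ω → Secret
  /-- the shares -/
  share : (v : V) → Ω → Share v
  measurable_secret : Measurable secret
  measurable_share : ∀ v, Measurable (share v)
  entropy_secret_pos : 0 < shannonEntropy μ secret
  entropy_secret_lt_top : shannonEntropy μ secret < ∞
  recover : ∀ v w, G.Adj v w →
    ∃ g : Share v → Share w → Secret, ∀ᵐ ω ∂μ, secret ω = g (share v ω) (share w ω)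
  perfect : ∀ A : Set V, G.IsIndepSet A →
    IndepFun secret (fun ω (v : A) => share v.1 ω) μ

namespace SecretSharingScheme

attribute [instance] measurableSpaceΩ isProbabilityMeasure countableSecret measurableSpaceSecret
  discreteSecret countableShare measurableSpaceShare discreteShare

/-- The information ratio of the vertex `v`: entropy of its share over entropy of the secret. -/
def ratio {V : Type} {G : SimpleGraph V} (S : SecretSharingScheme G) (v : V) : ℝ≥0∞ :=
  shannonEntropy S.μ (S.share v) / shannonEntropy S.μ S.secret

/-- The worst case information ratio of a scheme. -/
def worstRatio {V : Type} {G : SimpleGraph V} (S : SecretSharingScheme G) : ℝ≥0∞ :=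
  ⨆ v : V, S.ratio v

/-- The average information ratio of a scheme on a finite graph. -/
def averageRatio {V : Type} [Fintype V] {G : SimpleGraph V} (S : SecretSharingScheme G) :
    ℝ≥0∞ :=
  (∑ v : V, S.ratio v) / (Fintype.card V : ℝ≥0∞)

end SecretSharingScheme

/-- The (worst case) information ratio of a finite or infinite graph. -/
def informationRatio {V : Type} (G : SimpleGraph V) : ℝ≥0∞ :=
  ⨅ S : SecretSharingScheme G, S.worstRatio

/-- The average information ratio of a finite graph. -/
def averageInformationRatio {V : Type} [Fintype V] (G : SimpleGraph V) : ℝ≥0∞ :=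
  ⨅ S : SecretSharingScheme G, S.averageRatio

/-- The average information ratio of the subgraph of `G` spanned by a finite set of vertices. -/
def spannedAverageRatio {V : Type} (G : SimpleGraph V) (W : Finset V) : ℝ≥0∞ :=
  averageInformationRatio (G.induce (W : Set V))

/-- The average information ratio of a possibly infinite graph: the supremum over its finite
nonempty spanned subgraphs. -/
def localAverageInformationRatio {V : Type} (G : SimpleGraph V) : ℝ≥0∞ :=
  ⨆ (W : Finset V) (_ : W.Nonempty), spannedAverageRatio G W

/-- The `d`-dimensional lattice: integer points, two being adjacent when they differ in a single
coordinate, by exactly one. -/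
def latticeGraph (d : ℕ) : SimpleGraph (Fin d → ℤ) where
  Adj x y := ∃ i, |x i - y i| = 1 ∧ ∀ j, j ≠ i → x j = y j
  symm := ⟨by
    rintro x y ⟨i, hi, h⟩
    exact ⟨i, by rwa [abs_sub_comm], fun j hj => (h j hj).symm⟩⟩
  loopless := ⟨by
    rintro x ⟨i, hi, -⟩
    simp at hi⟩

/-- The vertices of the finite lattice box with `k` vertices along each dimension. -/
def latticeBox (d k : ℕ) : Finset (Fin d → ℤ) :=
  Fintype.piFinset fun _ => Finset.Ico (0 : ℤ) (k : ℤ)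

end

/-! The lower bound counts edges. The joint entropies `f` of the shares of finite sets form a
polymatroid in which monotonicity and submodularity gain the entropy `h` of the secret whenever the
secret is obtained on one side only (`IsGraphPolymatroid`). Let `A` and `B` be the even and odd
points of a box with an even side, so that they have equal size. When two boxes are glued along a
face, the sum of their brackets drops by a sum of conditional mutual informations (`bracket_union`),
and each edge across the cut forces a drop of at least `h` (`le_condMutualInfo_add`).

The box is assembled from dominoes. The bracket of a domino is at most the sum of its two singleton
values, and the bracket of the whole box is at least `h * A.card` (`mul_card_le_bracket`), which
makes up for the edges inside the dominoes, one for each point of `A`. Hence every edge contributes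
`h` to the sum of the singleton entropies (`mul_latticeEdgeCount_le`). A box of side `k` has about
`d * k ^ d` edges, so the average ratio is at least `d` in the limit.

For the upper bound the secret is a vector of `d - 1` bits, extended by a coordinate `s 0 = 0`. In
each coordinate plane two classes of disjoint unit squares are chosen so that every edge lies in a
square of one of them. Each square carries a random bit `r`; its even corners receive `r` and its
odd corners `r + s i + s j`. An edge in direction `i` then reveals all sums `s i + s j`, hence the
secret. An independent set meets a square in points of one parity, so it sees only bits translated
by a function of the secret, and learns nothing. A share has `d * (d - 1)` bits, which gives ratio
at most `d` at every vertex. -/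

section Entropy

/-! ### Shannon inequalities for discrete variables with possibly infinite entropy -/

variable {Ω S T U : Type} [MeasurableSpace Ω] {μ : Measure Ω}
  [Countable S] [MeasurableSpace S] [DiscreteMeasurableSpace S]
  [Countable T] [MeasurableSpace T] [DiscreteMeasurableSpace T]
  [Countable U] [MeasurableSpace U] [DiscreteMeasurableSpace U]

theorem lintegral_comp_eq_tsum {X : Ω → S} (hX : Measurable X) (f : S → ℝ≥0∞) :
    ∫⁻ ω, f (X ω) ∂μ = ∑' x, f x * μ (X ⁻¹' {x}) := by
  rw [← lintegral_map (measurable_of_countable f) hX, lintegral_countable']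
  exact tsum_congr fun x => by rw [Measure.map_apply hX (measurableSet_singleton x)]

/-- Entropy as expected surprisal turns entropy inequalities into almost sure pointwise inequalities
on `Ω`, with no finiteness assumption. -/
theorem shannonEntropy_eq_lintegral [IsProbabilityMeasure μ] {X : Ω → S} (hX : Measurable X) :
    shannonEntropy μ X = ∫⁻ ω, ENNReal.ofReal (-Real.log (μ.real (X ⁻¹' {X ω}))) ∂μ := by
  rw [lintegral_comp_eq_tsum hX fun x => ENNReal.ofReal (-Real.log (μ.real (X ⁻¹' {x})))]
  refine tsum_congr fun x => ?_
  rw [← ofReal_measureReal (μ := μ) (s := X ⁻¹' {x}), ← ENNReal.ofReal_mul' measureReal_nonneg,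
    Real.negMulLog]
  congr 1
  ring

theorem measurable_surprisal {X : Ω → S} (hX : Measurable X) :
    Measurable fun ω => ENNReal.ofReal (-Real.log (μ.real (X ⁻¹' {X ω}))) :=
  (measurable_of_countable fun x => ENNReal.ofReal (-Real.log (μ.real (X ⁻¹' {x})))).comp hX

theorem shannonEntropy_congr {α : Type} {X Y : Ω → α} (h : X =ᵐ[μ] Y) :
    shannonEntropy μ X = shannonEntropy μ Y := by
  refine tsum_congr fun x => ?_
  congr 2
  refine measureReal_congr ?_
  filter_upwards [h] with ω hω
  change (X ω = x) = (Y ω = x)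
  rw [hω]

theorem ae_measureReal_preimage_pos {α : Type} [Countable α] [IsProbabilityMeasure μ]
    (X : Ω → α) :
    ∀ᵐ ω ∂μ, 0 < μ.real (X ⁻¹' {X ω}) := by
  have h : μ (⋃ x ∈ {x : α | μ.real (X ⁻¹' {x}) = 0}, X ⁻¹' {x}) = 0 := by
    refine (measure_biUnion_null_iff (Set.to_countable _)).2 fun x hx => ?_
    exact (measureReal_eq_zero_iff).1 hx
  refine measure_mono_null (fun ω hω => ?_) h
  simp only [Set.mem_iUnion]
  exact ⟨X ω, le_antisymm (not_lt.1 hω) measureReal_nonneg, rfl⟩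

/-- A function of a random variable has at most the entropy of that variable. -/
theorem shannonEntropy_le_of_ae_eq_comp [IsProbabilityMeasure μ] {X : Ω → S} {Y : Ω → T}
    (hX : Measurable X) (g : S → T) (h : Y =ᵐ[μ] g ∘ X) :
    shannonEntropy μ Y ≤ shannonEntropy μ X := by
  rw [shannonEntropy_congr h, shannonEntropy_eq_lintegral hX,
    shannonEntropy_eq_lintegral ((measurable_of_countable g).comp hX)]
  refine lintegral_mono_ae ?_
  filter_upwards [ae_measureReal_preimage_pos X] with ω hω
  -- A fibre of `g ∘ X` contains a fibre of `X`, so its surprisal is smaller.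
  refine ENNReal.ofReal_le_ofReal (neg_le_neg (Real.log_le_log hω (measureReal_mono ?_)))
  intro ω' hω'
  simp only [Set.mem_preimage, Set.mem_singleton_iff, Function.comp_apply] at hω' ⊢
  rw [hω']

theorem tsum_measure_preimage_prodMk_le {X : Ω → S} {Z : Ω → U} (hX : Measurable X)
    (hZ : Measurable Z) (z : U) :
    ∑' x, μ ((fun ω => (X ω, Z ω)) ⁻¹' {(x, z)}) ≤ μ (Z ⁻¹' {z}) := by
  refine (tsum_meas_le_meas_iUnion_of_disjoint μ
    (fun x => (hX.prodMk hZ) (measurableSet_singleton _)) ?_).trans (measure_mono ?_)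
  · intro x y hxy
    refine Set.disjoint_left.2 fun ω h₁ h₂ => hxy ?_
    simp only [Set.mem_preimage, Set.mem_singleton_iff, Prod.mk.injEq] at h₁ h₂
    exact h₁.1.symm.trans h₂.1
  · refine Set.iUnion_subset fun x ω h => ?_
    simp only [Set.mem_preimage, Set.mem_singleton_iff, Prod.mk.injEq] at h
    exact h.2

/-- Weighting by `p(x,y,z)` cancels the denominator and leaves at most `∑ p(x,z) p(y,z) / p(z)`;
summing over `x` and `y` leaves at most `∑ p(z)`. It is the only analytic input to submodularity
besides `log t ≤ t - 1`. -/
theorem lintegral_likelihoodRatio_le_one [IsProbabilityMeasure μ] {X : Ω → S} {Y : Ω → T}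
    {Z : Ω → U} (hX : Measurable X) (hY : Measurable Y) (hZ : Measurable Z) :
    ∫⁻ ω, ENNReal.ofReal (μ.real ((fun ω => (X ω, Z ω)) ⁻¹' {(X ω, Z ω)}) *
      μ.real ((fun ω => (Y ω, Z ω)) ⁻¹' {(Y ω, Z ω)}) /
      (μ.real ((fun ω => (X ω, Y ω, Z ω)) ⁻¹' {(X ω, Y ω, Z ω)}) * μ.real (Z ⁻¹' {Z ω}))) ∂μ
      ≤ 1 := by
  set a : S → U → ℝ≥0∞ := fun x z => μ ((fun ω => (X ω, Z ω)) ⁻¹' {(x, z)}) with ha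
  set b : T → U → ℝ≥0∞ := fun y z => μ ((fun ω => (Y ω, Z ω)) ⁻¹' {(y, z)}) with hb
  set c : U → ℝ≥0∞ := fun z => μ (Z ⁻¹' {z}) with hc
  rw [lintegral_comp_eq_tsum (hX.prodMk (hY.prodMk hZ)) fun p : S × T × U =>
    ENNReal.ofReal (μ.real ((fun ω => (X ω, Z ω)) ⁻¹' {(p.1, p.2.2)}) *
      μ.real ((fun ω => (Y ω, Z ω)) ⁻¹' {(p.2.1, p.2.2)}) /
      (μ.real ((fun ω => (X ω, Y ω, Z ω)) ⁻¹' {p}) * μ.real (Z ⁻¹' {p.2.2})))]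
  have hterm : ∀ p : S × T × U,
      ENNReal.ofReal (μ.real ((fun ω => (X ω, Z ω)) ⁻¹' {(p.1, p.2.2)}) *
      μ.real ((fun ω => (Y ω, Z ω)) ⁻¹' {(p.2.1, p.2.2)}) /
      (μ.real ((fun ω => (X ω, Y ω, Z ω)) ⁻¹' {p}) * μ.real (Z ⁻¹' {p.2.2}))) *
      μ ((fun ω => (X ω, Y ω, Z ω)) ⁻¹' {p}) ≤ a p.1 p.2.2 * b p.2.1 p.2.2 / c p.2.2 := by
    rintro ⟨x, y, z⟩
    rcases eq_or_ne (μ.real ((fun ω => (X ω, Y ω, Z ω)) ⁻¹' {(x, y, z)})) 0 with h0 | h0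
    · rw [(measureReal_eq_zero_iff).1 h0, mul_zero]
      exact zero_le
    have hz : 0 < μ.real (Z ⁻¹' {z}) := by
      refine (lt_of_le_of_ne measureReal_nonneg (Ne.symm h0)).trans_le (measureReal_mono ?_)
      intro ω h
      simp only [Set.mem_preimage, Set.mem_singleton_iff, Prod.mk.injEq] at h
      exact h.2.2
    simp only [ha, hb, hc]
    rw [← ofReal_measureReal (μ := μ) (s := (fun ω => (X ω, Y ω, Z ω)) ⁻¹' {(x, y, z)}),
      ← ofReal_measureReal (μ := μ) (s := (fun ω => (X ω, Z ω)) ⁻¹' {(x, z)}),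
      ← ofReal_measureReal (μ := μ) (s := (fun ω => (Y ω, Z ω)) ⁻¹' {(y, z)}),
      ← ofReal_measureReal (μ := μ) (s := Z ⁻¹' {z}),
      ← ENNReal.ofReal_mul' measureReal_nonneg, ← ENNReal.ofReal_mul' measureReal_nonneg,
      ← ENNReal.ofReal_div_of_pos hz]
    refine ENNReal.ofReal_le_ofReal (le_of_eq ?_)
    field_simp
  refine (ENNReal.tsum_le_tsum hterm).trans ?_
  calc ∑' p : S × T × U, a p.1 p.2.2 * b p.2.1 p.2.2 / c p.2.2
      = ∑' z, (∑' x, a x z) * (∑' y, b y z) / c z := by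
        rw [ENNReal.tsum_prod']
        simp_rw [ENNReal.tsum_prod', ENNReal.tsum_comm (α := T)]
        rw [ENNReal.tsum_comm]
        refine tsum_congr fun z => ?_
        simp_rw [div_eq_mul_inv, ENNReal.tsum_mul_right, ENNReal.tsum_mul_left,
          ENNReal.tsum_mul_right]
    _ ≤ ∑' z, c z := by
        refine ENNReal.tsum_le_tsum fun z => ?_
        calc (∑' x, a x z) * (∑' y, b y z) / c z ≤ c z * c z / c z := by
              gcongr
              · exact tsum_measure_preimage_prodMk_le hX hZ z
              · exact tsum_measure_preimage_prodMk_le hY hZ z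
          _ ≤ c z := by
              rw [mul_div_assoc]
              exact (mul_le_mul_right ENNReal.div_self_le_one _).trans_eq (mul_one _)
    _ ≤ 1 := by
        refine (tsum_meas_le_meas_iUnion_of_disjoint μ
          (fun z => hZ (measurableSet_singleton z)) ?_).trans prob_le_one
        intro x y hxy
        exact Set.disjoint_left.2 fun ω h₁ h₂ => hxy (h₁.symm.trans h₂)

theorem shannonEntropy_submodular [IsProbabilityMeasure μ] {X : Ω → S} {Y : Ω → T} {Z : Ω → U}
    (hX : Measurable X) (hY : Measurable Y) (hZ : Measurable Z) :
    shannonEntropy μ (fun ω => (X ω, Y ω, Z ω)) + shannonEntropy μ Z ≤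
      shannonEntropy μ (fun ω => (X ω, Z ω)) + shannonEntropy μ (fun ω => (Y ω, Z ω)) := by
  have hXYZ := hX.prodMk (hY.prodMk hZ)
  have hXZ := hX.prodMk hZ
  have hYZ := hY.prodMk hZ
  -- Adding `1` to both sides expresses `log t ≤ t - 1`, for the likelihood ratio `t`, without
  -- subtraction in `ℝ≥0∞`.
  refine (ENNReal.add_le_add_iff_right ENNReal.one_ne_top).1 ?_
  refine le_trans ?_ (add_le_add_right (lintegral_likelihoodRatio_le_one (μ := μ) hX hY hZ) _)
  rw [shannonEntropy_eq_lintegral hXYZ, shannonEntropy_eq_lintegral hXZ,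
    shannonEntropy_eq_lintegral hYZ, shannonEntropy_eq_lintegral hZ]
  have h1 : (1 : ℝ≥0∞) = ∫⁻ _, 1 ∂μ := by simp
  rw [← lintegral_add_left (measurable_surprisal hXYZ), ← lintegral_add_left (measurable_surprisal hXZ)]
  conv_lhs => rw [h1]
  rw [← lintegral_add_left ((measurable_surprisal hXYZ).fun_add (measurable_surprisal hZ)),
    ← lintegral_add_left ((measurable_surprisal hXZ).fun_add (measurable_surprisal hYZ))]
  refine lintegral_mono_ae ?_
  filter_upwards [ae_measureReal_preimage_pos (μ := μ) fun ω => (X ω, Y ω, Z ω),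
    ae_measureReal_preimage_pos (μ := μ) fun ω => (X ω, Z ω),
    ae_measureReal_preimage_pos (μ := μ) fun ω => (Y ω, Z ω),
    ae_measureReal_preimage_pos (μ := μ) Z] with ω h₁ h₂ h₃ h₄
  have hn : ∀ s : Set Ω, 0 ≤ -Real.log (μ.real s) := fun s =>
    neg_nonneg.2 (Real.log_nonpos measureReal_nonneg measureReal_le_one)
  rw [← ENNReal.ofReal_one, ← ENNReal.ofReal_add (hn _) (hn _),
    ← ENNReal.ofReal_add (hn _) (hn _), ← ENNReal.ofReal_add (add_nonneg (hn _) (hn _)) zero_le_one,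
    ← ENNReal.ofReal_add (add_nonneg (hn _) (hn _)) (by positivity)]
  refine ENNReal.ofReal_le_ofReal ?_
  have hlog := Real.log_le_sub_one_of_pos (div_pos (mul_pos h₂ h₃) (mul_pos h₁ h₄))
  rw [Real.log_div (mul_pos h₂ h₃).ne' (mul_pos h₁ h₄).ne', Real.log_mul h₂.ne' h₃.ne',
    Real.log_mul h₁.ne' h₄.ne'] at hlog
  linarith

/-- Submodularity of entropy, for variables which determine each other almost surely. -/
theorem shannonEntropy_add_le_of_ae_eq_comp {R : Type} [Countable R] [MeasurableSpace R]
    [DiscreteMeasurableSpace R] [IsProbabilityMeasure μ] {X : Ω → S} {Y : Ω → T}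
    {Z : Ω → U} {W : Ω → R} (hX : Measurable X) (hY : Measurable Y) (hZ : Measurable Z)
    (p : S → U) (hp : Z =ᵐ[μ] p ∘ X) (q : T → U) (hq : Z =ᵐ[μ] q ∘ Y)
    (r : S × T → R) (hr : W =ᵐ[μ] fun ω => r (X ω, Y ω)) :
    shannonEntropy μ W + shannonEntropy μ Z ≤ shannonEntropy μ X + shannonEntropy μ Y := by
  refine le_trans (add_le_add_left ?_ _) ((shannonEntropy_submodular hX hY hZ).trans
    (add_le_add ?_ ?_))
  · exact shannonEntropy_le_of_ae_eq_comp (hX.prodMk (hY.prodMk hZ))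
      (fun t => r (t.1, t.2.1)) hr
  · refine shannonEntropy_le_of_ae_eq_comp hX (fun x => (x, p x)) ?_
    filter_upwards [hp] with ω h
    rw [h]; rfl
  · refine shannonEntropy_le_of_ae_eq_comp hY (fun y => (y, q y)) ?_
    filter_upwards [hq] with ω h
    rw [h]; rfl

theorem shannonEntropy_prodMk_of_indepFun [IsProbabilityMeasure μ] {X : Ω → S} {Y : Ω → T}
    (hX : Measurable X) (hY : Measurable Y) (h : IndepFun X Y μ) :
    shannonEntropy μ (fun ω => (X ω, Y ω)) = shannonEntropy μ X + shannonEntropy μ Y := by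
  rw [shannonEntropy_eq_lintegral (hX.prodMk hY), shannonEntropy_eq_lintegral hX,
    shannonEntropy_eq_lintegral hY, ← lintegral_add_left (measurable_surprisal hX)]
  refine lintegral_congr_ae ?_
  filter_upwards [ae_measureReal_preimage_pos (μ := μ) X,
    ae_measureReal_preimage_pos (μ := μ) Y] with ω h₁ h₂
  have hn : ∀ s : Set Ω, 0 ≤ -Real.log (μ.real s) := fun s =>
    neg_nonneg.2 (Real.log_nonpos measureReal_nonneg measureReal_le_one)
  have hprod : μ.real ((fun ω => (X ω, Y ω)) ⁻¹' {(X ω, Y ω)}) =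
      μ.real (X ⁻¹' {X ω}) * μ.real (Y ⁻¹' {Y ω}) := by
    rw [measureReal_def, measureReal_def, measureReal_def, ← ENNReal.toReal_mul,
      ← h.measure_inter_preimage_eq_mul _ _ (measurableSet_singleton _)
        (measurableSet_singleton _)]
    congr 2
    ext ω'
    simp
  rw [← ENNReal.ofReal_add (hn _) (hn _), hprod, Real.log_mul h₁.ne' h₂.ne', neg_add]

theorem shannonEntropy_of_unique {α : Type} [Unique α] [IsProbabilityMeasure μ] (X : Ω → α) :
    shannonEntropy μ X = 0 := by
  have h : ∀ x : α, X ⁻¹' {x} = Set.univ := fun x => by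
    ext ω; simp [Subsingleton.elim (X ω) x]
  simp [shannonEntropy, h]

/-- A variable with finitely many values has at most the entropy of the uniform distribution. -/
theorem shannonEntropy_le_log_card {α : Type} [Fintype α] [Nonempty α] [MeasurableSpace α]
    [DiscreteMeasurableSpace α] [IsProbabilityMeasure μ] {X : Ω → α} (hX : Measurable X) :
    shannonEntropy μ X ≤ ENNReal.ofReal (Real.log (Fintype.card α)) := by
  have hN : (0 : ℝ) < Fintype.card α := by exact_mod_cast Fintype.card_pos
  have hsum : ∑ x, μ.real (X ⁻¹' {x}) = 1 := by
    rw [sum_measureReal_preimage_singleton _ fun x _ => hX (measurableSet_singleton x)]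
    simp
  rw [shannonEntropy, tsum_fintype, ← ENNReal.ofReal_sum_of_nonneg fun x _ =>
    Real.negMulLog_nonneg measureReal_nonneg measureReal_le_one]
  refine ENNReal.ofReal_le_ofReal ?_
  -- Jensen's inequality for the concave function `-t log t` with equal weights.
  have h := Real.concaveOn_negMulLog.le_map_sum (t := Finset.univ)
    (w := fun _ : α => (Fintype.card α : ℝ)⁻¹) (p := fun x => μ.real (X ⁻¹' {x}))
    (fun _ _ => by positivity) (by simp [hN.ne']) (fun _ _ => measureReal_nonneg)
  simp only [smul_eq_mul, ← Finset.mul_sum, hsum, mul_one, Real.negMulLog, Real.log_inv] at h ⊢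
  have h' := mul_le_mul_of_nonneg_left h hN.le
  rw [← mul_assoc, mul_inv_cancel₀ hN.ne', one_mul] at h'
  refine h'.trans (le_of_eq ?_)
  field_simp

theorem shannonEntropy_of_uniform {α : Type} [Fintype α] [Nonempty α] {X : Ω → α}
    (h : ∀ x, μ.real (X ⁻¹' {x}) = (Fintype.card α : ℝ)⁻¹) :
    shannonEntropy μ X = ENNReal.ofReal (Real.log (Fintype.card α)) := by
  have hN : (0 : ℝ) < Fintype.card α := by exact_mod_cast Fintype.card_pos
  simp only [shannonEntropy, h, tsum_fintype, Finset.sum_const, Finset.card_univ]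
  rw [← ENNReal.ofReal_nsmul, nsmul_eq_mul, Real.negMulLog, Real.log_inv]
  congr 1
  field_simp

end Entropy

/-! ### Polymatroid inequalities for brackets -/

/-- The properties of the joint entropies `f A` of the shares of finite sets `A` of vertices which
are used in the lower bound: `f` is a polymatroid, and it is strictly monotone and strictly
submodular, with gap `h`, when the secret is gained on one side only. -/
structure IsGraphPolymatroid {V : Type} [DecidableEq V] (G : SimpleGraph V) (W : Finset V)
    (f : Finset V → ℝ) (h : ℝ) : Prop where
  nonneg : 0 ≤ h
  empty : f ∅ = 0
  mono : ∀ {A B}, B ⊆ W → A ⊆ B → f A ≤ f B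
  submod : ∀ {A B}, A ⊆ W → B ⊆ W → f (A ∪ B) + f (A ∩ B) ≤ f A + f B
  strict_mono : ∀ {A B}, B ⊆ W → A ⊆ B → G.IsIndepSet A → ¬ G.IsIndepSet B → f A + h ≤ f B
  strict_submod : ∀ {A B}, A ⊆ W → B ⊆ W → ¬ G.IsIndepSet A → ¬ G.IsIndepSet B →
    G.IsIndepSet (A ∩ B : Finset V) → f (A ∪ B) + f (A ∩ B) + h ≤ f A + f B

theorem SimpleGraph.not_isIndepSet_of_adj {V : Type} {G : SimpleGraph V} {s : Set V} {a b : V}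
    (ha : a ∈ s) (hb : b ∈ s) (hab : G.Adj a b) : ¬ G.IsIndepSet s :=
  fun h => h ha hb hab.ne hab

/-- For disjoint `A` and `B` of equal size this is a sum of increments of `f` at `{a, b}` over
`A \ {a}`, for pairs `(a, b)` of elements of `A` and `B`. -/
noncomputable def bracket {V : Type} [DecidableEq V] (f : Finset V → ℝ) (A B : Finset V) : ℝ :=
  ∑ b ∈ B, f (insert b A) - ∑ a ∈ A, f (A.erase a)

/-- The conditional mutual information of `X` and `Y` given `Z`. -/
noncomputable def condMutualInfo {V : Type} [DecidableEq V] (f : Finset V → ℝ)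
    (X Y Z : Finset V) : ℝ :=
  f (X ∪ Z) + f (Y ∪ Z) - f (X ∪ (Y ∪ Z)) - f Z

namespace IsGraphPolymatroid

variable {V : Type} [DecidableEq V] {G : SimpleGraph V} {W : Finset V} {f : Finset V → ℝ} {h : ℝ}

theorem condMutualInfo_nonneg (hf : IsGraphPolymatroid G W f h) {X Y Z : Finset V} (hX : X ⊆ W)
    (hY : Y ⊆ W) (hZ : Z ⊆ W) (hXY : Disjoint X Y) : 0 ≤ condMutualInfo f X Y Z := by
  have h₁ := hf.submod (Finset.union_subset hX hZ) (Finset.union_subset hY hZ)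
  rw [← Finset.inter_union_distrib_right, Finset.disjoint_iff_inter_eq_empty.1 hXY,
    Finset.empty_union, Finset.union_union_union_comm, Finset.union_self,
    Finset.union_assoc] at h₁
  rw [condMutualInfo]
  linarith

/-- The two terms telescope into three submodularity defects. Two of them are merely nonnegative,
and the third gains `h` from the edge `ab`. -/
theorem le_condMutualInfo_add (hf : IsGraphPolymatroid G W f h) {A₁ A₂ : Finset V} {a b : V}
    (hA₁ : A₁ ⊆ W) (hA₂ : A₂ ⊆ W) (hbW : b ∈ W) (hdisj : Disjoint A₁ A₂)
    (hI : G.IsIndepSet (A₁ ∪ A₂ : Finset V)) (ha : a ∈ A₁) (hab : G.Adj a b)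
    (huniq : ∀ x ∈ A₁, G.Adj x b → x = a) (hnbr : ∃ y ∈ A₂, G.Adj y b) :
    h ≤ condMutualInfo f {b} A₁ A₂ + condMutualInfo f {a} A₂ (A₁.erase a) := by
  obtain ⟨y, hy, hyb⟩ := hnbr
  have haA₂ : a ∉ A₂ := Finset.disjoint_left.1 hdisj ha
  have hb : b ∉ A₁ ∪ A₂ := fun hb =>
    hI (Finset.mem_coe.2 (Finset.mem_union_left _ ha)) (Finset.mem_coe.2 hb) hab.ne hab
  rw [Finset.mem_union, not_or] at hb
  have hC : A₁.erase a ⊆ W := (Finset.erase_subset _ _).trans hA₁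
  have hbC : insert b (A₁.erase a) ⊆ W := Finset.insert_subset hbW hC
  have h₁ := hf.submod (A := insert b A₂) (B := A₁.erase a ∪ A₂)
    (Finset.insert_subset hbW hA₂) (Finset.union_subset hC hA₂)
  have h₂ := hf.submod (A := A₁) (B := insert b (A₁.erase a)) hA₁ hbC
  have e₁ : insert b A₂ ∪ (A₁.erase a ∪ A₂) = insert b (A₁.erase a) ∪ A₂ := by grind
  have e₂ : insert b A₂ ∩ (A₁.erase a ∪ A₂) = A₂ := by grind
  have e₃ : A₁ ∪ insert b (A₁.erase a) = insert b A₁ := by grind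
  have e₄ : A₁ ∩ insert b (A₁.erase a) = A₁.erase a := by grind
  have e₅ : insert b A₁ ∪ (insert b (A₁.erase a) ∪ A₂) = insert b (A₁ ∪ A₂) := by grind
  have e₆ : insert b A₁ ∩ (insert b (A₁.erase a) ∪ A₂) = insert b (A₁.erase a) := by
    have := Finset.disjoint_left.1 hdisj
    grind
  -- Both sets contain an edge at `b`: to `a` in the first, to `y` in the second. Their intersection
  -- is independent because `a` is the only neighbour of `b` in `A₁`.
  have h₃ := hf.strict_submod (A := insert b A₁) (B := insert b (A₁.erase a) ∪ A₂)
    (Finset.insert_subset hbW hA₁) (Finset.union_subset hbC hA₂)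
    (SimpleGraph.not_isIndepSet_of_adj (a := a) (b := b) (by simp [ha]) (by simp) hab)
    (SimpleGraph.not_isIndepSet_of_adj (a := y) (b := b) (by simp [hy]) (by simp) hyb)
    (by
      rw [e₆]
      intro p hp q hq hpq hadj
      simp only [Finset.coe_insert, Finset.coe_erase, Set.mem_insert_iff, Set.mem_sdiff,
        Finset.mem_coe, Set.mem_singleton_iff] at hp hq
      rcases hp with rfl | ⟨hp, hpa⟩ <;> rcases hq with rfl | ⟨hq, hqa⟩
      · exact hpq rfl
      · exact hqa (huniq q hq hadj.symm)
      · exact hpa (huniq p hp hadj)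
      · exact hI (by simp [hp]) (by simp [hq]) hpq hadj)
  rw [e₁, e₂] at h₁
  rw [e₃, e₄] at h₂
  rw [e₅, e₆] at h₃
  have e₇ : {a} ∪ A₁.erase a = A₁ := by grind
  have e₈ : {a} ∪ (A₂ ∪ A₁.erase a) = A₁ ∪ A₂ := by grind
  rw [condMutualInfo, condMutualInfo, e₇, e₈, ← Finset.insert_eq, ← Finset.insert_eq,
    Finset.union_comm A₂]
  linarith

/-- The edges `(a, σ a)` form a matching, so each uses its own pair of summands; the unmatched
summands are nonnegative. -/
theorem mul_card_le_sum_condMutualInfo (hf : IsGraphPolymatroid G W f h)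
    {A₁ A₂ B₂ : Finset V} (hA₁ : A₁ ⊆ W) (hA₂ : A₂ ⊆ W) (hB₂ : B₂ ⊆ W)
    (hdisj : Disjoint A₁ A₂) (hAB : Disjoint A₁ B₂)
    (hI : G.IsIndepSet (A₁ ∪ A₂ : Finset V)) (σ : V → V) (hσ : σ.Injective)
    (hadj : ∀ a, G.Adj a (σ a)) (huniq : ∀ x ∈ A₁, ∀ b ∈ B₂, G.Adj x b → b = σ x)
    (hnbr : ∀ b ∈ B₂, ∃ y ∈ A₂, G.Adj y b) :
    h * (A₁.filter fun a => σ a ∈ B₂).card ≤ ∑ b ∈ B₂, condMutualInfo f {b} A₁ A₂ +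
      ∑ a ∈ A₁, condMutualInfo f {a} A₂ (A₁.erase a) := by
  set M := A₁.filter fun a => σ a ∈ B₂ with hM
  have h₁ : ∑ a ∈ M, condMutualInfo f {σ a} A₁ A₂ ≤ ∑ b ∈ B₂, condMutualInfo f {b} A₁ A₂ := by
    rw [← Finset.sum_image (f := fun b => condMutualInfo f {b} A₁ A₂) hσ.injOn]
    refine Finset.sum_le_sum_of_subset_of_nonneg ?_ fun b hb _ => ?_
    · intro b hb
      obtain ⟨a, ha, rfl⟩ := Finset.mem_image.1 hb
      exact (Finset.mem_filter.1 ha).2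
    · exact hf.condMutualInfo_nonneg (Finset.singleton_subset_iff.2 (hB₂ hb)) hA₁ hA₂
        (Finset.disjoint_singleton_left.2 (Finset.disjoint_right.1 hAB hb))
  have h₂ : ∑ a ∈ M, condMutualInfo f {a} A₂ (A₁.erase a) ≤
      ∑ a ∈ A₁, condMutualInfo f {a} A₂ (A₁.erase a) := by
    refine Finset.sum_le_sum_of_subset_of_nonneg (Finset.filter_subset _ _) fun a ha _ => ?_
    exact hf.condMutualInfo_nonneg (Finset.singleton_subset_iff.2 (hA₁ ha)) hA₂
      ((Finset.erase_subset _ _).trans hA₁)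
      (Finset.disjoint_singleton_left.2 (Finset.disjoint_left.1 hdisj ha))
  refine le_trans ?_ (add_le_add h₁ h₂)
  rw [← Finset.sum_add_distrib, mul_comm, ← nsmul_eq_mul]
  refine Finset.card_nsmul_le_sum _ _ _ fun a ha => ?_
  rw [hM, Finset.mem_filter] at ha
  exact hf.le_condMutualInfo_add hA₁ hA₂ (hB₂ ha.2) hdisj hI ha.1 (hadj a)
    (fun x hx hxa => (hσ (huniq x hx _ ha.2 hxa)).symm) (hnbr _ ha.2)

/-- Submodularity makes increments shrink as the conditioning set grows from `A₁` or `A₂` to their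
union. The conditional mutual informations record this loss exactly. -/
theorem bracket_union (f : Finset V → ℝ) {A₁ A₂ B₁ B₂ : Finset V} (hA : Disjoint A₁ A₂)
    (hB : Disjoint B₁ B₂) (h₁ : A₁.card = B₁.card) (h₂ : A₂.card = B₂.card) :
    bracket f A₁ B₁ + bracket f A₂ B₂ = bracket f (A₁ ∪ A₂) (B₁ ∪ B₂) +
      (∑ b ∈ B₂, condMutualInfo f {b} A₁ A₂ +
        ∑ a ∈ A₁, condMutualInfo f {a} A₂ (A₁.erase a)) +
      (∑ b ∈ B₁, condMutualInfo f {b} A₂ A₁ +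
        ∑ a ∈ A₂, condMutualInfo f {a} A₁ (A₂.erase a)) := by
  have key : ∀ {A A' B : Finset V}, Disjoint A A' → A.card = B.card →
      ∑ b ∈ B, condMutualInfo f {b} A' A + ∑ a ∈ A, condMutualInfo f {a} A' (A.erase a) =
        bracket f A B - (∑ b ∈ B, f (insert b (A ∪ A')) - ∑ a ∈ A, f ((A ∪ A').erase a)) := by
    intro A A' B hd hc
    -- The constant `f (A ∪ A') - f A` enters once for each `b` with a plus and once for each `a`
    -- with a minus, and cancels as `A` and `B` have equal size.
    have e₁ : ∀ b ∈ B, condMutualInfo f {b} A' A =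
        f (insert b A) - f (insert b (A ∪ A')) + (f (A ∪ A') - f A) := fun b _ => by
      rw [condMutualInfo, ← Finset.insert_eq, ← Finset.insert_eq, Finset.union_comm A']
      ring
    have e₂ : ∀ a ∈ A, condMutualInfo f {a} A' (A.erase a) =
        f ((A ∪ A').erase a) - f (A.erase a) - (f (A ∪ A') - f A) := fun a ha => by
      have ha' : a ∉ A' := Finset.disjoint_left.1 hd ha
      have e₃ : {a} ∪ A.erase a = A := by grind
      have e₄ : {a} ∪ (A' ∪ A.erase a) = A ∪ A' := by grind
      have e₅ : A' ∪ A.erase a = (A ∪ A').erase a := by grind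
      rw [condMutualInfo, e₃, e₄, e₅]
      ring
    rw [Finset.sum_congr rfl e₁, Finset.sum_congr rfl e₂, bracket]
    simp only [Finset.sum_add_distrib, Finset.sum_sub_distrib, Finset.sum_const, hc]
    ring
  have k₁ := key hA h₁
  have k₂ := key hA.symm h₂
  rw [Finset.union_comm A₂ A₁] at k₂
  have e : bracket f (A₁ ∪ A₂) (B₁ ∪ B₂) =
      (∑ b ∈ B₁, f (insert b (A₁ ∪ A₂)) - ∑ a ∈ A₁, f ((A₁ ∪ A₂).erase a)) +
      (∑ b ∈ B₂, f (insert b (A₁ ∪ A₂)) - ∑ a ∈ A₂, f ((A₁ ∪ A₂).erase a)) := by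
    rw [bracket, Finset.sum_union hB, Finset.sum_union hA]
    ring
  linarith

/-- Comparing every term with `f A` suffices: adding `b` creates an edge and gains `h`, and removing
`a` does not increase `f`. -/
theorem mul_card_le_bracket (hf : IsGraphPolymatroid G W f h) {A B : Finset V} (hA : A ⊆ W)
    (hB : B ⊆ W) (hc : A.card = B.card) (hI : G.IsIndepSet A)
    (hnbr : ∀ b ∈ B, ∃ a ∈ A, G.Adj a b) : h * A.card ≤ bracket f A B := by
  have h₁ : B.card • (f A + h) ≤ ∑ b ∈ B, f (insert b A) := by
    refine Finset.card_nsmul_le_sum _ _ _ fun b hb => ?_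
    obtain ⟨a, ha, hab⟩ := hnbr b hb
    exact hf.strict_mono (Finset.insert_subset (hB hb) hA) (Finset.subset_insert _ _) hI
      (SimpleGraph.not_isIndepSet_of_adj (a := a) (b := b) (by simp [ha]) (by simp) hab)
  have h₂ : ∑ a ∈ A, f (A.erase a) ≤ A.card • f A :=
    Finset.sum_le_card_nsmul _ _ _ fun a _ => hf.mono hA (Finset.erase_subset _ _)
  rw [← hc] at h₁
  rw [bracket]
  simp only [nsmul_eq_mul] at h₁ h₂
  linarith

end IsGraphPolymatroid

/-! ### Edge counting in lattice boxes -/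

section Lattice

variable {d : ℕ}

/-- The neighbour of a lattice point in the positive direction `i`. -/
def latticeShift (i : Fin d) (v : Fin d → ℤ) : Fin d → ℤ := v + Pi.single i 1

theorem latticeShift_apply_self (i : Fin d) (v : Fin d → ℤ) : latticeShift i v i = v i + 1 := by
  simp [latticeShift]

theorem latticeShift_apply_of_ne {i j : Fin d} (h : j ≠ i) (v : Fin d → ℤ) :
    latticeShift i v j = v j := by
  simp [latticeShift, h]

theorem le_latticeShift (i j : Fin d) (v : Fin d → ℤ) : v j ≤ latticeShift i v j := by
  rcases eq_or_ne j i with rfl | h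
  · rw [latticeShift_apply_self]; omega
  · rw [latticeShift_apply_of_ne h]

theorem latticeShift_injective (i : Fin d) : (latticeShift i).Injective :=
  add_left_injective _

theorem sum_latticeShift (i : Fin d) (v : Fin d → ℤ) :
    ∑ j, latticeShift i v j = ∑ j, v j + 1 := by
  simp [latticeShift, Finset.sum_add_distrib]

theorem latticeGraph_adj_latticeShift (i : Fin d) (v : Fin d → ℤ) :
    (latticeGraph d).Adj v (latticeShift i v) :=
  ⟨i, by simp [latticeShift_apply_self], fun j hj => (latticeShift_apply_of_ne hj v).symm⟩

theorem latticeGraph_adj_iff {v w : Fin d → ℤ} :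
    (latticeGraph d).Adj v w ↔ ∃ i, w = latticeShift i v ∨ v = latticeShift i w := by
  constructor
  · rintro ⟨i, hi, h⟩
    refine ⟨i, ?_⟩
    rcases eq_or_eq_neg_of_abs_eq hi with hi | hi
    · refine Or.inr (funext fun j => ?_)
      rcases eq_or_ne j i with rfl | hj
      · rw [latticeShift_apply_self]; omega
      · rw [latticeShift_apply_of_ne hj, h j hj]
    · refine Or.inl (funext fun j => ?_)
      rcases eq_or_ne j i with rfl | hj
      · rw [latticeShift_apply_self]; omega
      · rw [latticeShift_apply_of_ne hj, h j hj]
  · rintro ⟨i, rfl | rfl⟩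
    · exact latticeGraph_adj_latticeShift i v
    · exact (latticeGraph_adj_latticeShift i w).symm

theorem even_sum_iff_of_adj {v w : Fin d → ℤ} (h : (latticeGraph d).Adj v w) :
    Even (∑ j, v j) ↔ ¬ Even (∑ j, w j) := by
  obtain ⟨i, rfl | rfl⟩ := latticeGraph_adj_iff.1 h
  · rw [sum_latticeShift, Int.even_add_one, not_not]
  · rw [sum_latticeShift, Int.even_add_one]

/-- The points of `W` with even coordinate sum. -/
def evenPart (W : Finset (Fin d → ℤ)) : Finset (Fin d → ℤ) := W.filter fun v => Even (∑ j, v j)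

/-- The points of `W` with odd coordinate sum. -/
def oddPart (W : Finset (Fin d → ℤ)) : Finset (Fin d → ℤ) := W.filter fun v => ¬ Even (∑ j, v j)

theorem mem_evenPart {W : Finset (Fin d → ℤ)} {v : Fin d → ℤ} :
    v ∈ evenPart W ↔ v ∈ W ∧ Even (∑ j, v j) := Finset.mem_filter

theorem mem_oddPart {W : Finset (Fin d → ℤ)} {v : Fin d → ℤ} :
    v ∈ oddPart W ↔ v ∈ W ∧ ¬ Even (∑ j, v j) := Finset.mem_filter

theorem isIndepSet_evenPart (W : Finset (Fin d → ℤ)) :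
    (latticeGraph d).IsIndepSet (evenPart W) := by
  intro v hv w hw _ h
  rw [Finset.mem_coe, mem_evenPart] at hv hw
  exact (even_sum_iff_of_adj h).1 hv.2 hw.2

/-- The number of lattice edges spanned by `W`. -/
def latticeEdgeCount (W : Finset (Fin d → ℤ)) : ℕ :=
  ∑ i, (W.filter fun v => latticeShift i v ∈ W).card

theorem latticeEdgeCount_union_le {W₁ W₂ : Finset (Fin d → ℤ)} (i : Fin d) (c : ℤ)
    (h₁ : ∀ v ∈ W₁, v i < c) (h₂ : ∀ v ∈ W₂, c ≤ v i) :
    latticeEdgeCount (W₁ ∪ W₂) ≤ latticeEdgeCount W₁ + latticeEdgeCount W₂ +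
      (W₁.filter fun v => latticeShift i v ∈ W₂).card := by
  have h : ∀ j : Fin d, ((W₁ ∪ W₂).filter fun v => latticeShift j v ∈ W₁ ∪ W₂).card ≤
      (W₁.filter fun v => latticeShift j v ∈ W₁).card +
      (W₂.filter fun v => latticeShift j v ∈ W₂).card +
      if j = i then (W₁.filter fun v => latticeShift i v ∈ W₂).card else 0 := by
    intro j
    have hsub : ((W₁ ∪ W₂).filter fun v => latticeShift j v ∈ W₁ ∪ W₂) ⊆
        (W₁.filter fun v => latticeShift j v ∈ W₁) ∪
        (W₂.filter fun v => latticeShift j v ∈ W₂) ∪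
        if j = i then (W₁.filter fun v => latticeShift i v ∈ W₂) else ∅ := by
      intro v hv
      simp only [Finset.mem_filter, Finset.mem_union] at hv ⊢
      rcases hv with ⟨hv | hv, hs | hs⟩
      · exact Or.inl (Or.inl ⟨hv, hs⟩)
      · right
        have hji : j = i := by
          by_contra hne
          have := h₂ _ hs
          rw [latticeShift_apply_of_ne (Ne.symm hne)] at this
          exact absurd (h₁ v hv) (not_lt.2 this)
        subst hji
        simp [hv, hs]
      · exact absurd (h₁ _ hs) (not_lt.2 ((h₂ v hv).trans (le_latticeShift j i v)))
      · exact Or.inl (Or.inr ⟨hv, hs⟩)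
    refine (Finset.card_le_card hsub).trans ((Finset.card_union_le _ _).trans
      (add_le_add (Finset.card_union_le _ _) ?_))
    split_ifs <;> simp
  refine (Finset.sum_le_sum fun j _ => h j).trans_eq ?_
  simp only [latticeEdgeCount, Finset.sum_add_distrib, Finset.sum_ite_eq', Finset.mem_univ,
    if_true]

/-- Sets of lattice points for which the bracket of the two parity classes is bounded in terms
of the values of `f` at single points, with a gain for every edge. -/
structure IsBracketBounded (f : Finset (Fin d → ℤ) → ℝ) (h : ℝ) (W : Finset (Fin d → ℤ)) :
    Prop where
  balanced : (evenPart W).card = (oddPart W).card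
  exists_adj : ∀ v ∈ W, ∃ w ∈ W, (latticeGraph d).Adj w v
  bound : bracket f (evenPart W) (oddPart W) + h * latticeEdgeCount W ≤
    ∑ v ∈ W, f {v} + h * (evenPart W).card

variable {W : Finset (Fin d → ℤ)} {f : Finset (Fin d → ℤ) → ℝ} {h : ℝ}

/-- Gluing across a hyperplane preserves the bound, because the drop of the brackets pays for the
new edges. The neighbour condition provides the second edge needed for strict submodularity. -/
theorem IsBracketBounded.union (hf : IsGraphPolymatroid (latticeGraph d) W f h)
    {W₁ W₂ : Finset (Fin d → ℤ)} (hW₁ : W₁ ⊆ W) (hW₂ : W₂ ⊆ W) (i : Fin d) (c : ℤ)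
    (h₁ : ∀ v ∈ W₁, v i < c) (h₂ : ∀ v ∈ W₂, c ≤ v i) (hb₁ : IsBracketBounded f h W₁)
    (hb₂ : IsBracketBounded f h W₂) : IsBracketBounded f h (W₁ ∪ W₂) := by
  have hdisj : Disjoint W₁ W₂ := Finset.disjoint_left.2 fun v hv₁ hv₂ =>
    absurd (h₁ v hv₁) (not_lt.2 (h₂ v hv₂))
  have hE : evenPart (W₁ ∪ W₂) = evenPart W₁ ∪ evenPart W₂ := Finset.filter_union _ _ _
  have hO : oddPart (W₁ ∪ W₂) = oddPart W₁ ∪ oddPart W₂ := Finset.filter_union _ _ _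
  have sE : ∀ U : Finset (Fin d → ℤ), evenPart U ⊆ U := fun U => Finset.filter_subset _ _
  have sO : ∀ U : Finset (Fin d → ℤ), oddPart U ⊆ U := fun U => Finset.filter_subset _ _
  have dE : Disjoint (evenPart W₁) (evenPart W₂) := Finset.disjoint_of_subset_left (sE _)
    (Finset.disjoint_of_subset_right (sE _) hdisj)
  have dO : Disjoint (oddPart W₁) (oddPart W₂) := Finset.disjoint_of_subset_left (sO _)
    (Finset.disjoint_of_subset_right (sO _) hdisj)
  have hcross : ∀ x ∈ W₁, ∀ y ∈ W₂, (latticeGraph d).Adj x y → y = latticeShift i x := by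
    intro x hx y hy hxy
    have hlt := (h₁ x hx).trans_le (h₂ y hy)
    obtain ⟨j, rfl | rfl⟩ := latticeGraph_adj_iff.1 hxy
    · rcases eq_or_ne i j with rfl | hne
      · rfl
      · rw [latticeShift_apply_of_ne hne] at hlt
        exact absurd hlt (lt_irrefl _)
    · exact absurd hlt (not_lt.2 (le_latticeShift j i y))
  have hnbr : ∀ {U : Finset (Fin d → ℤ)}, IsBracketBounded f h U → ∀ b ∈ oddPart U,
      ∃ y ∈ evenPart U, (latticeGraph d).Adj y b := by
    intro U hU b hb
    rw [mem_oddPart] at hb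
    obtain ⟨y, hy, hyb⟩ := hU.exists_adj b hb.1
    exact ⟨y, mem_evenPart.2 ⟨hy, (even_sum_iff_of_adj hyb).2 hb.2⟩, hyb⟩
  let σ : (Fin d → ℤ) → (Fin d → ℤ) := fun v => v - Pi.single i 1
  have hσl : ∀ v, latticeShift i (σ v) = v := fun v => by simp [latticeShift, σ]
  have hσr : ∀ v, σ (latticeShift i v) = v := fun v => by simp [latticeShift, σ]
  -- `g₁` treats the crossing edges whose even end is in `W₁`, and `g₂` those whose even end is in
  -- `W₂`. The two use disjoint groups of correction terms in `bracket_union`.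
  have g₁ := hf.mul_card_le_sum_condMutualInfo ((sE W₁).trans hW₁) ((sE W₂).trans hW₂)
    ((sO W₂).trans hW₂) dE (Finset.disjoint_of_subset_left (sE _)
      (Finset.disjoint_of_subset_right (sO _) hdisj)) (hE ▸ isIndepSet_evenPart _)
    (latticeShift i) (latticeShift_injective i) (latticeGraph_adj_latticeShift i)
    (fun x hx b hb hxb => hcross x (sE _ hx) b (sO _ hb) hxb) (hnbr hb₂)
  have g₂ := hf.mul_card_le_sum_condMutualInfo ((sE W₂).trans hW₂) ((sE W₁).trans hW₁)
    ((sO W₁).trans hW₁) dE.symm (Finset.disjoint_of_subset_left (sE _)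
      (Finset.disjoint_of_subset_right (sO _) hdisj.symm))
    (Finset.union_comm (evenPart W₁) _ ▸ hE ▸ isIndepSet_evenPart _)
    σ (sub_left_injective)
    (fun a => by
      have := latticeGraph_adj_latticeShift i (σ a)
      rw [hσl] at this
      exact this.symm)
    (fun x hx b hb hxb => by
      rw [hcross b (sO _ hb) x (sE _ hx) hxb.symm, hσr]) (hnbr hb₁)
  have hcount : (W₁.filter fun v => latticeShift i v ∈ W₂).card ≤
      ((evenPart W₁).filter fun a => latticeShift i a ∈ oddPart W₂).card +
      ((evenPart W₂).filter fun a => σ a ∈ oddPart W₁).card := by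
    rw [← Finset.card_image_of_injective (s := (evenPart W₂).filter fun a => σ a ∈ oddPart W₁)
      (f := σ) sub_left_injective]
    refine (Finset.card_le_card fun v hv => ?_).trans (Finset.card_union_le _ _)
    rw [Finset.mem_filter] at hv
    have hpar := even_sum_iff_of_adj (latticeGraph_adj_latticeShift i v)
    rw [Finset.mem_union, Finset.mem_filter, Finset.mem_image]
    by_cases hv' : Even (∑ j, v j)
    · exact Or.inl ⟨mem_evenPart.2 ⟨hv.1, hv'⟩, mem_oddPart.2 ⟨hv.2, hpar.1 hv'⟩⟩
    · refine Or.inr ⟨latticeShift i v, ?_, hσr v⟩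
      rw [Finset.mem_filter, hσr]
      exact ⟨mem_evenPart.2 ⟨hv.2, not_not.1 fun hn => hv' (hpar.2 hn)⟩, mem_oddPart.2 ⟨hv.1, hv'⟩⟩
  refine ⟨?_, ?_, ?_⟩
  · rw [hE, hO, Finset.card_union_of_disjoint dE, Finset.card_union_of_disjoint dO, hb₁.balanced,
      hb₂.balanced]
  · intro v hv
    rcases Finset.mem_union.1 hv with hv | hv
    · obtain ⟨w, hw, hwv⟩ := hb₁.exists_adj v hv
      exact ⟨w, Finset.mem_union_left _ hw, hwv⟩
    · obtain ⟨w, hw, hwv⟩ := hb₂.exists_adj v hv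
      exact ⟨w, Finset.mem_union_right _ hw, hwv⟩
  · have hbr := IsGraphPolymatroid.bracket_union f dE dO hb₁.balanced hb₂.balanced
    have hedge : (latticeEdgeCount (W₁ ∪ W₂) : ℝ) ≤ latticeEdgeCount W₁ + latticeEdgeCount W₂ +
        (((evenPart W₁).filter fun a => latticeShift i a ∈ oddPart W₂).card +
        ((evenPart W₂).filter fun a => σ a ∈ oddPart W₁).card) := by
      exact_mod_cast (latticeEdgeCount_union_le i c h₁ h₂).trans (by gcongr)
    have hedge' := mul_le_mul_of_nonneg_left hedge hf.nonneg
    have b₁ := hb₁.bound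
    have b₂ := hb₂.bound
    rw [Finset.sum_union hdisj, hE, hO, Finset.card_union_of_disjoint dE]
    push_cast
    linarith

/-- The bracket of a domino is the value of `f` on the pair, so submodularity suffices; the single
edge is balanced by the single even point. -/
theorem isBracketBounded_pair (hf : IsGraphPolymatroid (latticeGraph d) W f h) (i : Fin d)
    {x : Fin d → ℤ} (hx : x ∈ W) (hx' : latticeShift i x ∈ W) :
    IsBracketBounded f h {x, latticeShift i x} := by
  have hadj := latticeGraph_adj_latticeShift i x
  have hpar := even_sum_iff_of_adj hadj
  have hcount : latticeEdgeCount {x, latticeShift i x} ≤ 1 := by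
    have : ∀ j : Fin d, (({x, latticeShift i x} : Finset (Fin d → ℤ)).filter
        fun v => latticeShift j v ∈ ({x, latticeShift i x} : Finset (Fin d → ℤ))).card ≤
        if j = i then 1 else 0 := by
      intro j
      have hsub : (({x, latticeShift i x} : Finset (Fin d → ℤ)).filter
        fun v => latticeShift j v ∈ ({x, latticeShift i x} : Finset (Fin d → ℤ))) ⊆
        if j = i then {x} else ∅ := by
        intro v hv
        simp only [Finset.mem_filter, Finset.mem_insert, Finset.mem_singleton] at hv
        have hsum := sum_latticeShift j v
        have hsumx := sum_latticeShift i x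
        rcases hv with ⟨rfl | rfl, hv | hv⟩
        · rw [hv] at hsum; omega
        · have hji : j = i := by
            by_contra hne
            have := congrFun hv j
            rw [latticeShift_apply_self, latticeShift_apply_of_ne hne] at this
            omega
          simp [hji]
        · rw [hv] at hsum; omega
        · rw [hv] at hsum; omega
      refine (Finset.card_le_card hsub).trans ?_
      split_ifs <;> simp
    exact (Finset.sum_le_sum fun j _ => this j).trans_eq (by simp)
  have hcount' : h * (latticeEdgeCount {x, latticeShift i x} : ℝ) ≤ h * 1 :=
    mul_le_mul_of_nonneg_left (by exact_mod_cast hcount) hf.nonneg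
  have hsub := hf.submod (A := {x}) (B := {latticeShift i x}) (by simpa using hx)
    (by simpa using hx')
  have hinter : ({x} : Finset (Fin d → ℤ)) ∩ {latticeShift i x} = ∅ :=
    Finset.disjoint_iff_inter_eq_empty.1 (by simpa using hadj.ne)
  rw [hinter, hf.empty, ← Finset.insert_eq] at hsub
  have hexists : ∀ v ∈ ({x, latticeShift i x} : Finset (Fin d → ℤ)),
      ∃ w ∈ ({x, latticeShift i x} : Finset (Fin d → ℤ)), (latticeGraph d).Adj w v := by
    intro v hv
    rw [Finset.mem_insert, Finset.mem_singleton] at hv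
    rcases hv with rfl | rfl
    · exact ⟨_, by simp, hadj.symm⟩
    · exact ⟨x, by simp, hadj⟩
  by_cases hxe : Even (∑ j, x j)
  · have e₁ : evenPart {x, latticeShift i x} = {x} := by
      rw [evenPart, Finset.filter_insert, if_pos hxe, Finset.filter_singleton, if_neg (hpar.1 hxe)]
      rfl
    have e₂ : oddPart {x, latticeShift i x} = {latticeShift i x} := by
      rw [oddPart, Finset.filter_insert, if_neg (not_not.2 hxe), Finset.filter_singleton,
        if_pos (hpar.1 hxe)]
    refine ⟨by simp [e₁, e₂], hexists, ?_⟩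
    rw [Finset.sum_pair hadj.ne, e₁, e₂, bracket]
    simp only [Finset.sum_singleton, Finset.erase_singleton, hf.empty, Finset.card_singleton,
      Nat.cast_one, Finset.pair_comm (latticeShift i x) x]
    linarith
  · have hxo : Even (∑ j, latticeShift i x j) := not_not.1 fun hn => hxe (hpar.2 hn)
    have e₁ : evenPart {x, latticeShift i x} = {latticeShift i x} := by
      rw [evenPart, Finset.filter_insert, if_neg hxe, Finset.filter_singleton, if_pos hxo]
    have e₂ : oddPart {x, latticeShift i x} = {x} := by
      rw [oddPart, Finset.filter_insert, if_pos hxe, Finset.filter_singleton,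
        if_neg (not_not.2 hxo)]
      rfl
    refine ⟨by simp [e₁, e₂], hexists, ?_⟩
    rw [Finset.sum_pair hadj.ne, e₁, e₂, bracket]
    simp only [Finset.sum_singleton, Finset.erase_singleton, hf.empty, Finset.card_singleton,
      Nat.cast_one]
    linarith

/-- The lattice box with corner `x` and side lengths `n`. -/
noncomputable def shiftedBox (x : Fin d → ℤ) (n : Fin d → ℕ) : Finset (Fin d → ℤ) :=
  Fintype.piFinset fun i => Finset.Ico (x i) (x i + n i)

theorem mem_shiftedBox {x v : Fin d → ℤ} {n : Fin d → ℕ} :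
    v ∈ shiftedBox x n ↔ ∀ i, x i ≤ v i ∧ v i < x i + n i := by
  simp [shiftedBox, Fintype.mem_piFinset]

theorem shiftedBox_eq_union (x : Fin d → ℤ) (n : Fin d → ℕ) (i : Fin d) {k l : ℕ}
    (hkl : n i = k + l) :
    shiftedBox x n = shiftedBox x (Function.update n i k) ∪
      shiftedBox (Function.update x i (x i + k)) (Function.update n i l) := by
  ext v
  simp only [Finset.mem_union, mem_shiftedBox]
  constructor
  · intro hv
    by_cases hvi : v i < x i + k
    · left
      intro j
      rcases eq_or_ne j i with rfl | hj
      · simpa using ⟨(hv j).1, hvi⟩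
      · simpa [hj] using hv j
    · right
      intro j
      rcases eq_or_ne j i with rfl | hj
      · have := hv j
        simp only [Function.update_self]
        omega
      · simpa [hj] using hv j
  · rintro (hv | hv) j
    · have hj' := hv j
      rcases eq_or_ne j i with rfl | hj
      · simp only [Function.update_self] at hj'
        omega
      · simpa [hj] using hj'
    · have hj' := hv j
      rcases eq_or_ne j i with rfl | hj
      · simp only [Function.update_self] at hj'
        omega
      · simpa [hj] using hj'

/-- Induction on the sum of the side lengths, by cutting the box in two. Cuts across `i₀` keep both
sides even, so that the parity classes remain balanced. -/
theorem isBracketBounded_shiftedBox (hf : IsGraphPolymatroid (latticeGraph d) W f h) (i₀ : Fin d)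
    (x : Fin d → ℤ) (n : Fin d → ℕ) (hpos : ∀ i, 0 < n i) (heven : Even (n i₀))
    (hW : shiftedBox x n ⊆ W) : IsBracketBounded f h (shiftedBox x n) := by
  induction hN : ∑ i, n i using Nat.strong_induction_on generalizing x n with
  | _ N ih =>
  subst hN
  by_cases hsplit : ∃ i k l, 0 < k ∧ 0 < l ∧ n i = k + l ∧ (i = i₀ → Even k ∧ Even l)
  · obtain ⟨i, k, l, hk, hl, hkl, he⟩ := hsplit
    have hlt : ∀ m, m < n i → ∑ j, Function.update n i m j < ∑ j, n j := fun m hm =>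
      Finset.sum_lt_sum (fun j _ => by
        rcases eq_or_ne j i with rfl | hj
        · simpa using hm.le
        · simp [hj]) ⟨i, Finset.mem_univ _, by simpa using hm⟩
    have hpos' : ∀ m, 0 < m → ∀ j, 0 < Function.update n i m j := fun m hm j => by
      rcases eq_or_ne j i with rfl | hj
      · simpa using hm
      · simpa [hj] using hpos j
    have heven' : ∀ m, (i = i₀ → Even m) → Even (Function.update n i m i₀) := fun m hm => by
      rcases eq_or_ne i₀ i with rfl | hj
      · simpa using hm rfl
      · simpa [hj] using heven
    have hu := shiftedBox_eq_union x n i hkl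
    have hW₁ : shiftedBox x (Function.update n i k) ⊆ W :=
      (hu ▸ Finset.subset_union_left).trans hW
    have hW₂ : shiftedBox (Function.update x i (x i + k)) (Function.update n i l) ⊆ W :=
      (hu ▸ Finset.subset_union_right).trans hW
    rw [hu]
    refine IsBracketBounded.union hf hW₁ hW₂ i (x i + k) (fun v hv => ?_) (fun v hv => ?_)
      (ih _ (hlt k (by omega)) _ _ (hpos' k hk) (heven' k fun h => (he h).1) hW₁ rfl)
      (ih _ (hlt l (by omega)) _ _ (hpos' l hl) (heven' l fun h => (he h).2) hW₂ rfl)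
    · simpa using (mem_shiftedBox.1 hv i).2
    · simpa using (mem_shiftedBox.1 hv i).1
  -- A box admitting no such cut is a domino in direction `i₀`.
  · have hn₀ : n i₀ = 2 := by
      by_contra hne
      obtain ⟨r, hr⟩ := heven
      have := hpos i₀
      exact hsplit ⟨i₀, n i₀ - 2, 2, by omega, by omega, by omega,
        fun _ => ⟨⟨r - 1, by omega⟩, ⟨1, rfl⟩⟩⟩
    have hn : ∀ i, i ≠ i₀ → n i = 1 := by
      intro i hi
      by_contra hne
      have := hpos i
      exact hsplit ⟨i, n i - 1, 1, by omega, by omega, by omega, fun h => absurd h hi⟩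
    have hbox : shiftedBox x n = {x, latticeShift i₀ x} := by
      ext v
      rw [mem_shiftedBox, Finset.mem_insert, Finset.mem_singleton]
      constructor
      · intro hv
        have hne : ∀ j, j ≠ i₀ → v j = x j := fun j hj => by
          have := hv j
          rw [hn j hj] at this
          omega
        have h₀ := hv i₀
        rw [hn₀] at h₀
        rcases eq_or_ne (v i₀) (x i₀) with he | he
        · left
          funext j
          rcases eq_or_ne j i₀ with rfl | hj
          · exact he
          · exact hne j hj
        · right
          funext j
          rcases eq_or_ne j i₀ with rfl | hj
          · rw [latticeShift_apply_self]; omega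
          · rw [latticeShift_apply_of_ne hj, hne j hj]
      · rintro (rfl | rfl) j
        · have := hpos j
          omega
        · rcases eq_or_ne j i₀ with rfl | hj
          · rw [latticeShift_apply_self, hn₀]; omega
          · rw [latticeShift_apply_of_ne hj, hn j hj]; omega
    rw [hbox] at hW ⊢
    exact isBracketBounded_pair hf i₀ (hW (by simp)) (hW (by simp))

/-- In a box with an even side, every edge contributes `h` to the sum of the values of `f`. -/
theorem mul_latticeEdgeCount_le (hf : IsGraphPolymatroid (latticeGraph d) W f h) (i₀ : Fin d)
    (x : Fin d → ℤ) (n : Fin d → ℕ) (hpos : ∀ i, 0 < n i) (heven : Even (n i₀))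
    (hW : shiftedBox x n ⊆ W) :
    h * latticeEdgeCount (shiftedBox x n) ≤ ∑ v ∈ shiftedBox x n, f {v} := by
  have hb := isBracketBounded_shiftedBox hf i₀ x n hpos heven hW
  have hbr := hf.mul_card_le_bracket (A := evenPart (shiftedBox x n))
    (B := oddPart (shiftedBox x n)) ((Finset.filter_subset _ _).trans hW)
    ((Finset.filter_subset _ _).trans hW) hb.balanced (isIndepSet_evenPart _) (fun b hb' => by
      rw [mem_oddPart] at hb'
      obtain ⟨y, hy, hyb⟩ := hb.exists_adj b hb'.1
      exact ⟨y, mem_evenPart.2 ⟨hy, (even_sum_iff_of_adj hyb).2 hb'.2⟩, hyb⟩)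
  have := hb.bound
  linarith

theorem card_latticeBox (d k : ℕ) : (latticeBox d k).card = k ^ d := by
  simp [latticeBox, Fintype.card_piFinset]

/-- Only one side has to be even, so rounding one side down to an even number costs a negligible
number of edges. -/
theorem mul_pow_le_sum_latticeBox {k : ℕ} (hd : 0 < d) (hk : 2 ≤ k)
    (hf : IsGraphPolymatroid (latticeGraph d) (latticeBox d k) f h) :
    h * (d * ((k - 2 : ℕ) : ℝ) ^ d) ≤ ∑ v ∈ latticeBox d k, f {v} := by
  let i₀ : Fin d := ⟨0, hd⟩
  let n : Fin d → ℕ := fun i => if i = i₀ then 2 * (k / 2) else k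
  have hn : ∀ i, k - 1 ≤ n i ∧ n i ≤ k := fun i => by
    simp only [n]
    split_ifs <;> omega
  have hbox : ∀ {v}, v ∈ latticeBox d k ↔ ∀ i, 0 ≤ v i ∧ v i < k := fun {v} => by
    simp [latticeBox, Fintype.mem_piFinset]
  have hsub : shiftedBox 0 n ⊆ latticeBox d k := fun v hv => hbox.2 fun i => by
    have h₁ := mem_shiftedBox.1 hv i
    have h₂ := hn i
    simp only [Pi.zero_apply] at h₁
    omega
  -- All sides are at least `k - 1`, so a point of the box of side `k - 2` and its shift in any
  -- direction both stay inside.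
  have hcount : d * (k - 2) ^ d ≤ latticeEdgeCount (shiftedBox 0 n) := by
    have : ∀ i : Fin d, (k - 2) ^ d ≤
        ((shiftedBox 0 n).filter fun v => latticeShift i v ∈ shiftedBox 0 n).card := by
      intro i
      rw [← card_latticeBox d (k - 2)]
      refine Finset.card_le_card fun v hv => ?_
      simp only [latticeBox, Fintype.mem_piFinset, Finset.mem_Ico] at hv
      rw [Finset.mem_filter, mem_shiftedBox, mem_shiftedBox]
      refine ⟨fun j => ?_, fun j => ?_⟩
      · have h₁ := hv j
        have h₂ := hn j
        simp only [Pi.zero_apply]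
        omega
      · have h₁ := hv j
        have h₂ := hn j
        have h₃ : latticeShift i v j = v j ∨ latticeShift i v j = v j + 1 := by
          rcases eq_or_ne j i with rfl | hj
          · exact Or.inr (latticeShift_apply_self j v)
          · exact Or.inl (latticeShift_apply_of_ne hj v)
        simp only [Pi.zero_apply]
        omega
    simpa [latticeEdgeCount] using Finset.card_nsmul_le_sum Finset.univ _ _ fun i _ => this i
  calc h * (d * ((k - 2 : ℕ) : ℝ) ^ d) ≤ h * latticeEdgeCount (shiftedBox 0 n) :=
        mul_le_mul_of_nonneg_left (by exact_mod_cast hcount) hf.nonneg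
    _ ≤ ∑ v ∈ shiftedBox 0 n, f {v} :=
        mul_latticeEdgeCount_le hf i₀ 0 n (fun i => by have := hn i; omega)
          (by simp [n]) hsub
    _ ≤ ∑ v ∈ latticeBox d k, f {v} := by
        refine Finset.sum_le_sum_of_subset_of_nonneg hsub fun v hv _ => ?_
        rw [← hf.empty]
        exact hf.mono (Finset.singleton_subset_iff.2 hv) (Finset.empty_subset _)

end Lattice

/-! ### Joint share entropies form a graph polymatroid -/

namespace SecretSharingScheme

variable {V : Type} {G : SimpleGraph V} (S : SecretSharingScheme G)

/-- The shares of a finite set of vertices, as a single random variable. -/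
def jointShare (A : Finset V) (ω : S.Ω) (v : A) : S.Share v := S.share v ω

theorem measurable_jointShare (A : Finset V) : Measurable (S.jointShare A) :=
  measurable_pi_lambda _ fun v => S.measurable_share v

theorem exists_secret_ae_eq_comp_jointShare {A : Finset V} (hA : ¬ G.IsIndepSet A) :
    ∃ g : ((v : A) → S.Share v) → S.Secret, S.secret =ᵐ[S.μ] g ∘ S.jointShare A := by
  simp only [SimpleGraph.IsIndepSet, Set.Pairwise, not_forall, not_not] at hA
  obtain ⟨v, hv, w, hw, -, hadj⟩ := hA
  obtain ⟨g, hg⟩ := S.recover v w hadj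
  exact ⟨fun x => g (x ⟨v, hv⟩) (x ⟨w, hw⟩), hg⟩

/-- A set containing an edge knows the secret, so the secret can be adjoined to any part of its
shares at no cost. Both strict inequalities rest on this. -/
theorem exists_prodMk_ae_eq_comp_jointShare {A B : Finset V} (hAB : A ⊆ B)
    (hB : ¬ G.IsIndepSet B) :
    ∃ g : ((v : B) → S.Share v) → S.Secret × ((v : A) → S.Share v),
      (fun ω => (S.secret ω, S.jointShare A ω)) =ᵐ[S.μ] g ∘ S.jointShare B := by
  obtain ⟨g, hg⟩ := S.exists_secret_ae_eq_comp_jointShare hB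
  refine ⟨fun x => (g x, fun v => x ⟨v, hAB v.2⟩), ?_⟩
  filter_upwards [hg] with ω hω
  rw [hω]
  rfl

theorem entropy_secret_jointShare {A : Finset V} (hA : G.IsIndepSet A) :
    shannonEntropy S.μ (fun ω => (S.secret ω, S.jointShare A ω)) =
      shannonEntropy S.μ S.secret + shannonEntropy S.μ (S.jointShare A) :=
  shannonEntropy_prodMk_of_indepFun S.measurable_secret (S.measurable_jointShare A)
    (S.perfect A hA)

theorem entropy_jointShare_empty : shannonEntropy S.μ (S.jointShare ∅) = 0 :=
  shannonEntropy_of_unique _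

theorem entropy_jointShare_mono {A B : Finset V} (h : A ⊆ B) :
    shannonEntropy S.μ (S.jointShare A) ≤ shannonEntropy S.μ (S.jointShare B) :=
  shannonEntropy_le_of_ae_eq_comp (S.measurable_jointShare B) (fun x v => x ⟨v, h v.2⟩)
    (ae_of_all _ fun _ => rfl)

theorem entropy_jointShare_singleton (v : V) :
    shannonEntropy S.μ (S.jointShare {v}) = shannonEntropy S.μ (S.share v) := by
  refine le_antisymm ?_ ?_
  · refine shannonEntropy_le_of_ae_eq_comp (S.measurable_share v)
      (fun x w => (Finset.mem_singleton.1 w.2).symm ▸ x) (ae_of_all _ fun ω => ?_)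
    funext ⟨w, hw⟩
    obtain rfl := Finset.mem_singleton.1 hw
    rfl
  · exact shannonEntropy_le_of_ae_eq_comp (S.measurable_jointShare {v})
      (fun x => x ⟨v, Finset.mem_singleton_self v⟩) (ae_of_all _ fun _ => rfl)

theorem entropy_jointShare_strict_mono {A B : Finset V} (hAB : A ⊆ B) (hA : G.IsIndepSet A)
    (hB : ¬ G.IsIndepSet B) :
    shannonEntropy S.μ (S.jointShare A) + shannonEntropy S.μ S.secret ≤
      shannonEntropy S.μ (S.jointShare B) := by
  obtain ⟨g, hg⟩ := S.exists_prodMk_ae_eq_comp_jointShare hAB hB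
  rw [add_comm, ← S.entropy_secret_jointShare hA]
  exact shannonEntropy_le_of_ae_eq_comp (S.measurable_jointShare B) g hg

variable [DecidableEq V]

/-- The shares of a union as a function of the shares of the two parts. -/
def combineShares (A B : Finset V) (x : ((v : A) → S.Share v) × ((v : B) → S.Share v))
    (v : (A ∪ B : Finset V)) : S.Share v :=
  if h : v.1 ∈ A then x.1 ⟨v, h⟩ else x.2 ⟨v, (Finset.mem_union.1 v.2).resolve_left h⟩

theorem jointShare_union (A B : Finset V) (ω : S.Ω) :
    S.jointShare (A ∪ B) ω = S.combineShares A B (S.jointShare A ω, S.jointShare B ω) := by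
  funext v
  rw [combineShares]
  split_ifs <;> rfl

theorem entropy_jointShare_submod (A B : Finset V) :
    shannonEntropy S.μ (S.jointShare (A ∪ B)) + shannonEntropy S.μ (S.jointShare (A ∩ B)) ≤
      shannonEntropy S.μ (S.jointShare A) + shannonEntropy S.μ (S.jointShare B) :=
  shannonEntropy_add_le_of_ae_eq_comp (S.measurable_jointShare A) (S.measurable_jointShare B)
    (S.measurable_jointShare (A ∩ B)) (fun x v => x ⟨v, Finset.inter_subset_left v.2⟩)
    (ae_of_all _ fun _ => rfl) (fun x v => x ⟨v, Finset.inter_subset_right v.2⟩)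
    (ae_of_all _ fun _ => rfl) (S.combineShares A B) (ae_of_all _ (S.jointShare_union A B))

/-- Ordinary submodularity, with the secret adjoined to the common part `A ∩ B`: both sides know it,
and it is independent of the shares of the intersection. -/
theorem entropy_jointShare_strict_submod {A B : Finset V} (hA : ¬ G.IsIndepSet A)
    (hB : ¬ G.IsIndepSet B) (hAB : G.IsIndepSet (A ∩ B : Finset V)) :
    shannonEntropy S.μ (S.jointShare (A ∪ B)) + (shannonEntropy S.μ (S.jointShare (A ∩ B)) +
      shannonEntropy S.μ S.secret) ≤
      shannonEntropy S.μ (S.jointShare A) + shannonEntropy S.μ (S.jointShare B) := by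
  obtain ⟨p, hp⟩ := S.exists_prodMk_ae_eq_comp_jointShare (A := A ∩ B) Finset.inter_subset_left hA
  obtain ⟨q, hq⟩ := S.exists_prodMk_ae_eq_comp_jointShare (A := A ∩ B) Finset.inter_subset_right hB
  rw [add_comm (shannonEntropy S.μ (S.jointShare (A ∩ B))), ← S.entropy_secret_jointShare hAB]
  exact shannonEntropy_add_le_of_ae_eq_comp (S.measurable_jointShare A)
    (S.measurable_jointShare B) (S.measurable_secret.prodMk (S.measurable_jointShare (A ∩ B)))
    p hp q hq (S.combineShares A B) (ae_of_all _ (S.jointShare_union A B))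

theorem entropy_jointShare_ne_top (hfin : ∀ v, shannonEntropy S.μ (S.share v) ≠ ∞)
    (A : Finset V) : shannonEntropy S.μ (S.jointShare A) ≠ ∞ := by
  induction A using Finset.induction_on with
  | empty => simp [S.entropy_jointShare_empty]
  | insert v A _ ih =>
    have h := S.entropy_jointShare_submod {v} A
    rw [← Finset.insert_eq, S.entropy_jointShare_singleton] at h
    exact ne_top_of_le_ne_top (ENNReal.add_ne_top.2 ⟨hfin v, ih⟩) (le_self_add.trans h)

theorem isGraphPolymatroid_entropy [Fintype V]
    (hfin : ∀ v, shannonEntropy S.μ (S.share v) ≠ ∞) :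
    IsGraphPolymatroid G Finset.univ (fun A => (shannonEntropy S.μ (S.jointShare A)).toReal)
      (shannonEntropy S.μ S.secret).toReal := by
  have hF := S.entropy_jointShare_ne_top hfin
  have hS := S.entropy_secret_lt_top.ne
  refine ⟨ENNReal.toReal_nonneg, by simp [S.entropy_jointShare_empty], fun {A B} _ h => ?_,
    fun {A B} _ _ => ?_, fun {A B} _ h hA hB => ?_, fun {A B} _ _ hA hB hAB => ?_⟩
  · exact ENNReal.toReal_mono (hF B) (S.entropy_jointShare_mono h)
  · rw [← ENNReal.toReal_add (hF _) (hF _), ← ENNReal.toReal_add (hF _) (hF _)]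
    exact ENNReal.toReal_mono (ENNReal.add_ne_top.2 ⟨hF _, hF _⟩) (S.entropy_jointShare_submod A B)
  · rw [← ENNReal.toReal_add (hF _) hS]
    exact ENNReal.toReal_mono (hF B) (S.entropy_jointShare_strict_mono h hA hB)
  · rw [add_assoc, ← ENNReal.toReal_add (hF _) hS,
      ← ENNReal.toReal_add (hF _) (ENNReal.add_ne_top.2 ⟨hF _, hS⟩),
      ← ENNReal.toReal_add (hF _) (hF _)]
    exact ENNReal.toReal_mono (ENNReal.add_ne_top.2 ⟨hF _, hF _⟩)
      (S.entropy_jointShare_strict_submod hA hB hAB)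

end SecretSharingScheme

/-! ### The lower bound for finite boxes -/

theorem isIndepSet_subtype_iff {V : Type} [DecidableEq V] {G : SimpleGraph V} {W A : Finset V}
    (hA : A ⊆ W) :
    (G.induce (W : Set V)).IsIndepSet (A.subtype fun v => v ∈ (W : Set V) : Finset W) ↔
      G.IsIndepSet A := by
  constructor
  · intro h v hv w hw hne hadj
    exact h (x := ⟨v, hA hv⟩) (by simpa using hv) (y := ⟨w, hA hw⟩) (by simpa using hw)
      (by simpa using hne) hadj
  · intro h v hv w hw hne hadj
    exact h (by simpa using hv) (by simpa using hw) (fun h => hne (Subtype.ext h)) hadj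

/-- Moves the polymatroid from the subtype to subsets of `W` in the ambient graph, where boxes can
be cut and shifted. -/
theorem IsGraphPolymatroid.of_induce {V : Type} [DecidableEq V] {G : SimpleGraph V}
    {W : Finset V} {f : Finset (W : Set V) → ℝ} {h : ℝ}
    (hf : IsGraphPolymatroid (G.induce (W : Set V)) Finset.univ f h) :
    IsGraphPolymatroid G W (fun A => f (A.subtype fun v => v ∈ (W : Set V))) h := by
  have hu : ∀ A B : Finset V, (A ∪ B).subtype (fun v => v ∈ (W : Set V)) =
      A.subtype (fun v => v ∈ (W : Set V)) ∪ B.subtype (fun v => v ∈ (W : Set V)) :=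
    fun A B => by ext; simp
  have hi : ∀ A B : Finset V, (A ∩ B).subtype (fun v => v ∈ (W : Set V)) =
      A.subtype (fun v => v ∈ (W : Set V)) ∩ B.subtype (fun v => v ∈ (W : Set V)) :=
    fun A B => by ext; simp
  refine ⟨hf.nonneg, ?_, fun {A B} _ hAB => ?_, fun {A B} _ _ => ?_, fun {A B} hB hAB hA hB' => ?_,
    fun {A B} hA hB hA' hB' hAB => ?_⟩
  · exact (congrArg f (by ext; simp)).trans hf.empty
  · exact hf.mono (Finset.subset_univ _) (Finset.subtype_mono hAB)
  · rw [hu, hi]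
    exact hf.submod (Finset.subset_univ _) (Finset.subset_univ _)
  · exact hf.strict_mono (Finset.subset_univ _) (Finset.subtype_mono hAB)
      ((isIndepSet_subtype_iff (hAB.trans hB)).2 hA) (mt (isIndepSet_subtype_iff hB).1 hB')
  · rw [hu, hi]
    refine hf.strict_submod (Finset.subset_univ _) (Finset.subset_univ _)
      (mt (isIndepSet_subtype_iff hA).1 hA') (mt (isIndepSet_subtype_iff hB).1 hB') ?_
    rw [← hi]
    exact (isIndepSet_subtype_iff (Finset.inter_subset_left.trans hA)).2 hAB

theorem mul_pow_le_sum_ratio {d k : ℕ} (hd : 0 < d) (hk : 2 ≤ k)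
    (S : SecretSharingScheme ((latticeGraph d).induce (latticeBox d k : Set (Fin d → ℤ)))) :
    (d : ℝ≥0∞) * ((k - 2 : ℕ) : ℝ≥0∞) ^ d ≤ ∑ v, S.ratio v := by
  have hpos := S.entropy_secret_pos.ne'
  have htop := S.entropy_secret_lt_top.ne
  simp only [SecretSharingScheme.ratio, div_eq_mul_inv]
  rw [← Finset.sum_mul, ← div_eq_mul_inv,
    ENNReal.le_div_iff_mul_le (Or.inl hpos) (Or.inl htop)]
  -- The real-valued polymatroid requires finite entropies; a share of infinite entropy makes the
  -- bound trivial.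
  by_cases hfin : ∀ v, shannonEntropy S.μ (S.share v) ≠ ∞
  · have h := mul_pow_le_sum_latticeBox hd hk (S.isGraphPolymatroid_entropy hfin).of_induce
    have hs : ∀ v : (latticeBox d k : Set (Fin d → ℤ)), ({v.1} : Finset (Fin d → ℤ)).subtype
        (fun v => v ∈ (latticeBox d k : Set (Fin d → ℤ))) = {v} := fun v => by
      ext w
      rw [Finset.mem_subtype, Finset.mem_singleton, Finset.mem_singleton, Subtype.ext_iff]
    have h' : ∑ v ∈ latticeBox d k, (shannonEntropy S.μ (S.jointShare
        (({v} : Finset (Fin d → ℤ)).subtype fun v => v ∈ (latticeBox d k : Set (Fin d → ℤ))))).toReal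
        = (∑ v, shannonEntropy S.μ (S.share v)).toReal := by
      rw [ENNReal.toReal_sum fun v _ => hfin v, ← Finset.sum_coe_sort]
      refine Fintype.sum_equiv (Equiv.refl _) _ _ fun v => ?_
      rw [hs v, S.entropy_jointShare_singleton]
      rfl
    rw [h'] at h
    refine (ENNReal.toReal_le_toReal ?_ (ENNReal.sum_ne_top.2 fun v _ => hfin v)).1 ?_
    · exact ENNReal.mul_ne_top (ENNReal.mul_ne_top (ENNReal.natCast_ne_top d)
        (ENNReal.pow_ne_top (ENNReal.natCast_ne_top _))) htop
    · rw [ENNReal.toReal_mul, ENNReal.toReal_mul, ENNReal.toReal_pow, ENNReal.toReal_natCast,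
        ENNReal.toReal_natCast, mul_comm]
      exact h
  · push Not at hfin
    obtain ⟨v, hv⟩ := hfin
    rw [ENNReal.sum_eq_top.2 ⟨v, Finset.mem_univ _, hv⟩]
    exact le_top

theorem le_spannedAverageRatio_latticeBox {d k : ℕ} (hd : 0 < d) (hk : 2 ≤ k) :
    (d : ℝ≥0∞) * ((k - 2 : ℕ) : ℝ≥0∞) ^ d / (k : ℝ≥0∞) ^ d ≤
      spannedAverageRatio (latticeGraph d) (latticeBox d k) := by
  refine le_iInf fun S => ?_
  rw [SecretSharingScheme.averageRatio]
  have hc : Fintype.card (latticeBox d k : Set (Fin d → ℤ)) = k ^ d := by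
    rw [← card_latticeBox d k]
    simp
  rw [hc, Nat.cast_pow]
  gcongr
  exact mul_pow_le_sum_ratio hd hk S

theorem tendsto_mul_sub_two_pow_div (d : ℕ) :
    Tendsto (fun k : ℕ => (d : ℝ≥0∞) * ((k - 2 : ℕ) : ℝ≥0∞) ^ d / (k : ℝ≥0∞) ^ d) atTop
      (𝓝 (d : ℝ≥0∞)) := by
  have h₁ : Tendsto (fun k : ℕ => 1 - 2 / (k : ℝ)) atTop (𝓝 (1 - 0)) :=
    tendsto_const_nhds.sub (tendsto_const_div_atTop_nhds_zero_nat 2)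
  have h₂ : Tendsto (fun k : ℕ => (d : ℝ) * (1 - 2 / (k : ℝ)) ^ d) atTop (𝓝 (d : ℝ)) := by
    simpa using (h₁.pow d).const_mul (d : ℝ)
  have h₃ := ENNReal.tendsto_ofReal h₂
  rw [ENNReal.ofReal_natCast] at h₃
  refine h₃.congr' ?_
  filter_upwards [eventually_ge_atTop 2] with k hk
  have hk' : (0 : ℝ) < k := by exact_mod_cast (by omega : 0 < k)
  have e : (d : ℝ) * (1 - 2 / (k : ℝ)) ^ d = d * ((k - 2 : ℕ) : ℝ) ^ d / (k : ℝ) ^ d := by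
    rw [mul_div_assoc, ← div_pow, Nat.cast_sub hk, sub_div, div_self hk'.ne']
    norm_num
  rw [e, ENNReal.ofReal_div_of_pos (by positivity), ENNReal.ofReal_mul (by positivity),
    ENNReal.ofReal_pow (by positivity), ENNReal.ofReal_pow (by positivity),
    ENNReal.ofReal_natCast, ENNReal.ofReal_natCast, ENNReal.ofReal_natCast]

/-! ### Uniform bits and their translations -/

theorem IndepFun.comp_measurePreserving {Ω Ω' α β : Type*} [MeasurableSpace Ω]
    [MeasurableSpace Ω'] [MeasurableSpace α] [MeasurableSpace β] {μ : Measure Ω}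
    {ν : Measure Ω'} {X : Ω' → α} {Y : Ω' → β} (h : IndepFun X Y ν) (hX : Measurable X)
    (hY : Measurable Y) {φ : Ω → Ω'} (hφ : MeasurePreserving φ μ ν) :
    IndepFun (X ∘ φ) (Y ∘ φ) μ := by
  rw [indepFun_iff_measure_inter_preimage_eq_mul] at h ⊢
  intro s t hs ht
  rw [Set.preimage_comp, Set.preimage_comp, ← Set.preimage_inter,
    hφ.measure_preimage ((hX hs).inter (hY ht)).nullMeasurableSet,
    hφ.measure_preimage (hX hs).nullMeasurableSet, hφ.measure_preimage (hY ht).nullMeasurableSet,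
    h s t hs ht]

theorem map_add_right_uniformOn_univ {α : Type} [AddGroup α] [Fintype α] [MeasurableSpace α]
    [DiscreteMeasurableSpace α] (c : α) :
    Measure.map (fun x => x + c) (uniformOn (Set.univ : Set α)) = uniformOn Set.univ := by
  refine Measure.ext_of_singleton fun x => ?_
  have h : (fun x => x + c) ⁻¹' {x} = {x - c} := by
    ext y
    rw [Set.mem_preimage, Set.mem_singleton_iff, Set.mem_singleton_iff, eq_sub_iff_add_eq]
  rw [Measure.map_apply (measurable_of_countable _) (measurableSet_singleton x), h,
    uniformOn_univ, uniformOn_univ, Measure.count_singleton, Measure.count_singleton]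

/-- The distribution of independent uniform bits. -/
noncomputable def uniformBits (ι : Type) : Measure (ι → ZMod 2) :=
  Measure.infinitePi fun _ => uniformOn Set.univ

instance (ι : Type) : IsProbabilityMeasure (uniformBits ι) := by
  have : ∀ _ : ι, IsProbabilityMeasure (uniformOn (Set.univ : Set (ZMod 2))) := fun _ =>
    isProbabilityMeasure_uniformOn Set.finite_univ Set.univ_nonempty
  exact inferInstanceAs (IsProbabilityMeasure (Measure.infinitePi _))

theorem map_add_right_uniformBits {ι : Type} (c : ι → ZMod 2) :
    Measure.map (fun r => r + c) (uniformBits ι) = uniformBits ι := by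
  have : ∀ _ : ι, IsProbabilityMeasure (uniformOn (Set.univ : Set (ZMod 2))) := fun _ =>
    isProbabilityMeasure_uniformOn Set.finite_univ Set.univ_nonempty
  have h := Measure.infinitePi_map_pi (fun _ : ι => uniformOn (Set.univ : Set (ZMod 2)))
    (f := fun i x => x + c i) fun i => measurable_of_countable _
  simp only [map_add_right_uniformOn_univ] at h
  exact h

/-! ### The chessboard scheme -/

namespace ChessboardScheme

variable {n : ℕ}

/-- Ordered pairs of distinct directions. The two orders of a pair stand for the two chessboard
classes of unit squares in the plane of these directions. -/
abbrev Plane (n : ℕ) : Type := {p : Fin (n + 1) × Fin (n + 1) // p.1 ≠ p.2}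

theorem card_plane (n : ℕ) : Fintype.card (Plane n) = (n + 1) * n := by
  have h : (Finset.univ : Finset (Fin (n + 1))).offDiag.card = (n + 1) * n := by
    rw [Finset.offDiag_card, Finset.card_univ, Fintype.card_fin]
    exact Nat.sub_eq_of_eq_add (by ring)
  rw [← h, Fintype.card_subtype]
  congr 1
  ext p
  simp

/-- The offset of the chessboard class. -/
def offset (p : Plane n) : ℤ := if p.1.1 < p.1.2 then 0 else 1

/-- A label of the unit square of the class `p` which contains the point `v`. -/
def square (p : Plane n) (v : Fin (n + 1) → ℤ) (l : Fin (n + 1)) : ℤ :=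
  if l = p.1.1 ∨ l = p.1.2 then (v l + offset p) / 2 else v l

/-- The part of the secret which is distributed on the squares of the class `p`. -/
def partialSecret (p : Plane n) (s : Fin n → ZMod 2) : ZMod 2 :=
  (Fin.cons 0 s : Fin (n + 1) → ZMod 2) p.1.1 + (Fin.cons 0 s : Fin (n + 1) → ZMod 2) p.1.2

/-- The parity of a lattice point. -/
def parity (v : Fin (n + 1) → ℤ) : ZMod 2 := ((∑ l, v l : ℤ) : ZMod 2)

/-- The sample space: the secret, and a random bit for every square. -/
abbrev Sample (n : ℕ) : Type := (Fin n → ZMod 2) × (Plane n × (Fin (n + 1) → ℤ) → ZMod 2)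

/-- The share of `v`: for each square which contains `v` its bit, to which the part of the secret
is added if `v` is odd. -/
def share (v : Fin (n + 1) → ℤ) (ω : Sample n) (p : Plane n) : ZMod 2 :=
  ω.2 (p, square p v) + parity v * partialSecret p ω.1

theorem parity_latticeShift (i : Fin (n + 1)) (v : Fin (n + 1) → ℤ) :
    parity (latticeShift i v) = parity v + 1 := by
  rw [parity, parity, sum_latticeShift]
  push_cast
  rfl

/-- Halving identifies `v i` with `v i + 1` when `v i` plus the offset is even. The two orders of
`i` and `j` realise both offsets, so one of them fits. -/
theorem exists_square_eq (v : Fin (n + 1) → ℤ) {i j : Fin (n + 1)} (hij : i ≠ j) :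
    ∃ p : Plane n, (p.1 = (i, j) ∨ p.1 = (j, i)) ∧ square p v = square p (latticeShift i v) := by
  have h : ∀ p : Plane n, (p.1 = (i, j) ∨ p.1 = (j, i)) →
      (v i + offset p) / 2 = (v i + 1 + offset p) / 2 →
      square p v = square p (latticeShift i v) := by
    intro p hp hv
    funext l
    rcases eq_or_ne l i with rfl | hl
    · have : l = p.1.1 ∨ l = p.1.2 := by
        rcases hp with hp | hp <;> simp [hp]
      rw [square, square, if_pos this, if_pos this, latticeShift_apply_self, hv]
    · rw [square, square, latticeShift_apply_of_ne hl]
  have hoff : ∀ e : ℤ, (e = 0 ∨ e = 1) →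
      ∃ p : Plane n, (p.1 = (i, j) ∨ p.1 = (j, i)) ∧ offset p = e := by
    rintro e he
    rcases lt_or_gt_of_ne hij with hlt | hlt <;> rcases he with rfl | rfl
    · exact ⟨⟨(i, j), hij⟩, Or.inl rfl, if_pos hlt⟩
    · exact ⟨⟨(j, i), hij.symm⟩, Or.inr rfl, if_neg hlt.not_gt⟩
    · exact ⟨⟨(j, i), hij.symm⟩, Or.inr rfl, if_pos hlt⟩
    · exact ⟨⟨(i, j), hij⟩, Or.inl rfl, if_neg hlt.not_gt⟩
  obtain ⟨e, he, he'⟩ : ∃ e : ℤ, (e = 0 ∨ e = 1) ∧ (v i + e) / 2 = (v i + 1 + e) / 2 := by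
    rcases Int.even_or_odd' (v i) with ⟨m, hm | hm⟩
    · exact ⟨0, Or.inl rfl, by omega⟩
    · exact ⟨1, Or.inr rfl, by omega⟩
  obtain ⟨p, hp, hpe⟩ := hoff e he
  exact ⟨p, hp, h p hp (by rw [hpe, he'])⟩

/-- The ends of an edge have opposite parity, so in a common square their entries differ by the
partial secret `s i + s j`. This is available for every `j ≠ i`. -/
theorem secret_eq_of_share_latticeShift_eq {v : Fin (n + 1) → ℤ} {i : Fin (n + 1)}
    {ω ω' : Sample n} (h : share v ω = share v ω')
    (h' : share (latticeShift i v) ω = share (latticeShift i v) ω') : ω.1 = ω'.1 := by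
  set s : Fin (n + 1) → ZMod 2 := Fin.cons 0 ω.1 with hs
  set s' : Fin (n + 1) → ZMod 2 := Fin.cons 0 ω'.1 with hs'
  have key : ∀ j, i ≠ j → s i + s j = s' i + s' j := by
    intro j hij
    obtain ⟨p, hp, hsq⟩ := exists_square_eq v hij
    have e₁ := congrFun h p
    have e₂ := congrFun h' p
    rw [share, share, hsq] at e₁
    rw [share, share, parity_latticeShift] at e₂
    have e₃ : partialSecret p ω.1 = partialSecret p ω'.1 := by linear_combination e₂ - e₁
    rcases hp with hp | hp
    · simpa [partialSecret, hp] using e₃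
    · rw [partialSecret, partialSecret, hp] at e₃
      linear_combination e₃
  -- The sums determine `s` only up to a constant; the prepended zero fixes it.
  have h₀ : s 0 = s' 0 := rfl
  have hi : s i = s' i := by
    rcases eq_or_ne i 0 with rfl | hi
    · exact h₀
    · linear_combination key 0 hi - h₀
  have hall : s = s' := by
    funext j
    rcases eq_or_ne i j with rfl | hj
    · exact hi
    · linear_combination key j hj - hi
  funext j
  exact congrFun hall j.succ

theorem exists_recover {v w : Fin (n + 1) → ℤ} (hadj : (latticeGraph (n + 1)).Adj v w) :
    ∃ g : (Plane n → ZMod 2) → (Plane n → ZMod 2) → (Fin n → ZMod 2),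
      ∀ ω : Sample n, ω.1 = g (share v ω) (share w ω) := by
  have h : Function.FactorsThrough (fun ω : Sample n => ω.1)
      (fun ω : Sample n => (share v ω, share w ω)) := by
    intro ω ω' he
    obtain ⟨h₁, h₂⟩ := Prod.mk.inj he
    obtain ⟨i, rfl | rfl⟩ := latticeGraph_adj_iff.1 hadj
    · exact secret_eq_of_share_latticeShift_eq h₁ h₂
    · exact secret_eq_of_share_latticeShift_eq h₂ h₁
  obtain ⟨e, he⟩ := (Function.factorsThrough_iff _).1 h
  exact ⟨fun x y => e (x, y), fun ω => congrFun he ω⟩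

/-- Coordinates of points in a common square differ by at most one, and only in directions `i` and
`j`. For nonadjacent points both differ or neither does. -/
theorem parity_eq_of_square_eq {p : Plane n} {v w : Fin (n + 1) → ℤ}
    (h : square p v = square p w) (hadj : ¬ (latticeGraph (n + 1)).Adj v w) :
    parity v = parity w := by
  obtain ⟨⟨i, j⟩, hij⟩ := p
  have hne : ∀ l, l ≠ i → l ≠ j → v l = w l := fun l hi hj => by
    simpa [square, hi, hj] using congrFun h l
  have hi : (v i + offset ⟨(i, j), hij⟩) / 2 = (w i + offset ⟨(i, j), hij⟩) / 2 := by
    simpa [square] using congrFun h i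
  have hj : (v j + offset ⟨(i, j), hij⟩) / 2 = (w j + offset ⟨(i, j), hij⟩) / 2 := by
    simpa [square] using congrFun h j
  have hsum : ∑ l, v l - ∑ l, w l = (v i - w i) + (v j - w j) := by
    rw [← Finset.sum_sub_distrib]
    exact Finset.sum_eq_add i j hij (fun l _ hl => sub_eq_zero.2 (hne l hl.1 hl.2))
      (fun h => absurd (Finset.mem_univ _) h) (fun h => absurd (Finset.mem_univ _) h)
  have hi' : ¬ (|v i - w i| = 1 ∧ v j = w j) := fun hc => hadj ⟨i, hc.1, fun l hl => by
    rcases eq_or_ne l j with rfl | hlj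
    · exact hc.2
    · exact hne l hl hlj⟩
  have hj' : ¬ (|v j - w j| = 1 ∧ v i = w i) := fun hc => hadj ⟨j, hc.1, fun l hl => by
    rcases eq_or_ne l i with rfl | hli
    · exact hc.2
    · exact hne l hli hl⟩
  rw [parity, parity, ZMod.intCast_eq_intCast_iff_dvd_sub]
  push_cast
  rw [abs_eq zero_le_one] at hi' hj'
  omega

/-- The part of the secret added to the bit of a square, from the point of view of an independent
set `A`, all of whose elements in a square have the same parity. -/
noncomputable def mask (A : Set (Fin (n + 1) → ℤ)) (s : Fin n → ZMod 2)
    (q : Plane n × (Fin (n + 1) → ℤ)) : ZMod 2 :=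
  open Classical in
  if ∃ v ∈ A, square q.1 v = q.2 ∧ parity v = 1 then partialSecret q.1 s else 0

theorem parity_mul_partialSecret {A : Set (Fin (n + 1) → ℤ)}
    (hA : (latticeGraph (n + 1)).IsIndepSet A) {v : Fin (n + 1) → ℤ} (hv : v ∈ A) (p : Plane n)
    (s : Fin n → ZMod 2) : parity v * partialSecret p s = mask A s (p, square p v) := by
  rw [mask]
  split_ifs with h
  · obtain ⟨w, hw, hsq, hpar⟩ := h
    have : parity w = parity v := parity_eq_of_square_eq hsq fun hadj => hA hw hv hadj.ne hadj
    rw [← this, hpar, one_mul]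
  · have h01 : ∀ x : ZMod 2, x ≠ 1 → x = 0 := by decide
    rw [h01 (parity v) fun hpar => h ⟨v, hv, rfl, hpar⟩, zero_mul]

/-- The distribution of a uniform secret and independent uniform bits. -/
noncomputable def measure (n : ℕ) : Measure (Sample n) := (uniformOn Set.univ).prod (uniformBits _)

instance (n : ℕ) : IsProbabilityMeasure (uniformOn (Set.univ : Set (Fin n → ZMod 2))) :=
  isProbabilityMeasure_uniformOn Set.finite_univ Set.univ_nonempty

instance (n : ℕ) : IsProbabilityMeasure (measure n) :=
  inferInstanceAs (IsProbabilityMeasure ((uniformOn Set.univ).prod (uniformBits _)))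

theorem measurable_share (v : Fin (n + 1) → ℤ) : Measurable (share v) := by
  refine measurable_pi_lambda _ fun p => ?_
  change Measurable fun ω : Sample n => ω.2 (p, square p v) + parity v * partialSecret p ω.1
  exact ((measurable_pi_apply _).comp measurable_snd).fun_add
    ((measurable_of_countable fun s => parity v * partialSecret p s).comp measurable_fst)

/-- For each fixed secret the mask is a translation of the bits, which leaves their uniform
distribution invariant. -/
theorem measurePreserving_mask (A : Set (Fin (n + 1) → ℤ)) :
    MeasurePreserving (fun ω : Sample n => (ω.1, ω.2 + mask A ω.1)) (measure n) (measure n) := by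
  refine MeasurePreserving.skew_product (MeasurePreserving.id _)
    (g := fun s r => r + mask A s) ?_ (ae_of_all _ fun s => map_add_right_uniformBits _)
  refine measurable_pi_lambda _ fun q => ?_
  exact ((measurable_pi_apply q).comp measurable_snd).add
    ((measurable_of_countable fun s => mask A s q).comp measurable_fst)

/-- On an independent set the shares are coordinates of the masked bits. Undoing the mask by
`measurePreserving_mask` reduces the claim to independence of the secret and the raw bits. -/
theorem indepFun_secret_share {A : Set (Fin (n + 1) → ℤ)}
    (hA : (latticeGraph (n + 1)).IsIndepSet A) :
    IndepFun (fun ω : Sample n => ω.1) (fun ω (v : A) => share v.1 ω) (measure n) := by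
  have hm : Measurable fun (r : Plane n × (Fin (n + 1) → ℤ) → ZMod 2) (v : A) (p : Plane n) =>
      r (p, square p v.1) :=
    measurable_pi_lambda _ fun v => measurable_pi_lambda _ fun p => measurable_pi_apply _
  have h := IndepFun.comp_measurePreserving (indepFun_prod (μ := uniformOn Set.univ)
    (ν := uniformBits (Plane n × (Fin (n + 1) → ℤ))) (measurable_id (α := Fin n → ZMod 2)) hm)
    (measurable_id.comp measurable_fst) (hm.comp measurable_snd) (measurePreserving_mask A)
  refine h.congr (ae_of_all _ fun ω => rfl) (ae_of_all _ fun ω => ?_)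
  funext v p
  simp only [Function.comp_apply, Pi.add_apply]
  rw [share, parity_mul_partialSecret hA v.2]

theorem shannonEntropy_secret (n : ℕ) :
    shannonEntropy (measure n) (fun ω => ω.1) = ENNReal.ofReal (n * Real.log 2) := by
  rw [shannonEntropy_of_uniform fun x => ?_]
  · rw [Fintype.card_fun, ZMod.card, Fintype.card_fin]
    push_cast
    rw [Real.log_pow]
  · have h : (fun ω : Sample n => ω.1) ⁻¹' {x} = {x} ×ˢ Set.univ := by
      ext ω; simp
    rw [h, measure, measureReal_def, Measure.prod_prod, measure_univ, mul_one, uniformOn_univ,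
      Measure.count_singleton, one_div, ENNReal.toReal_inv, ENNReal.toReal_natCast]

/-- A share consists of `(n + 1) * n` bits, which is `n + 1` times the length of the secret. -/
theorem shannonEntropy_share_le (v : Fin (n + 1) → ℤ) :
    shannonEntropy (measure n) (share v) ≤
      ((n + 1 : ℕ) : ℝ≥0∞) * ENNReal.ofReal (n * Real.log 2) := by
  refine (shannonEntropy_le_log_card (measurable_share v)).trans_eq ?_
  rw [Fintype.card_fun, ZMod.card, card_plane, ← ENNReal.ofReal_natCast,
    ← ENNReal.ofReal_mul (by positivity)]
  push_cast
  rw [Real.log_pow]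
  push_cast
  rw [mul_assoc]

end ChessboardScheme

/-- The scheme on the lattice in which parts of the secret are distributed on the unit squares in
all planes spanned by two directions. -/
noncomputable def chessboardScheme {n : ℕ} (hn : 0 < n) :
    SecretSharingScheme (latticeGraph (n + 1)) where
  Ω := ChessboardScheme.Sample n
  μ := ChessboardScheme.measure n
  Secret := Fin n → ZMod 2
  Share _ := ChessboardScheme.Plane n → ZMod 2
  secret ω := ω.1
  share := ChessboardScheme.share
  measurable_secret := measurable_fst
  measurable_share := ChessboardScheme.measurable_share
  entropy_secret_pos := by
    rw [ChessboardScheme.shannonEntropy_secret, ENNReal.ofReal_pos]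
    exact mul_pos (by exact_mod_cast hn) (Real.log_pos one_lt_two)
  entropy_secret_lt_top := by
    rw [ChessboardScheme.shannonEntropy_secret]
    exact ENNReal.ofReal_lt_top
  recover v w hadj := by
    obtain ⟨g, hg⟩ := ChessboardScheme.exists_recover hadj
    exact ⟨g, ae_of_all _ hg⟩
  perfect _ hA := ChessboardScheme.indepFun_secret_share hA

theorem exists_scheme_ratio_le {d : ℕ} (hd : 2 ≤ d) :
    ∃ S : SecretSharingScheme (latticeGraph d), ∀ v, S.ratio v ≤ d := by
  obtain ⟨n, rfl⟩ : ∃ n, d = n + 1 := ⟨d - 1, by omega⟩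
  refine ⟨chessboardScheme (by omega : 0 < n), fun v => ENNReal.div_le_of_le_mul ?_⟩
  refine (ChessboardScheme.shannonEntropy_share_le v).trans_eq ?_
  exact congrArg _ (ChessboardScheme.shannonEntropy_secret n).symm

/-! ### Restriction to spanned subgraphs and the conclusion -/

/-- The restriction of a scheme to a spanned subgraph. -/
def SecretSharingScheme.restrict {V : Type} {G : SimpleGraph V} (S : SecretSharingScheme G)
    (W : Set V) : SecretSharingScheme (G.induce W) where
  Ω := S.Ω
  μ := S.μ
  Secret := S.Secret
  Share v := S.Share v
  secret := S.secret
  share v := S.share v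
  measurable_secret := S.measurable_secret
  measurable_share v := S.measurable_share v
  entropy_secret_pos := S.entropy_secret_pos
  entropy_secret_lt_top := S.entropy_secret_lt_top
  recover v w hadj := S.recover v w hadj
  perfect A hA := by
    have hI : G.IsIndepSet (Subtype.val '' A) := by
      rintro _ ⟨v, hv, rfl⟩ _ ⟨w, hw, rfl⟩ hne hadj
      exact hA hv hw (fun h => hne (congrArg _ h)) hadj
    have hm : Measurable fun (x : (v : (Subtype.val '' A : Set V)) → S.Share v) (v : A) =>
        x ⟨v.1.1, ⟨v.1, v.2, rfl⟩⟩ :=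
      measurable_pi_lambda _ fun v => measurable_pi_apply _
    exact (S.perfect _ hI).comp measurable_id hm

theorem averageRatio_le_of_ratio_le {V : Type} [Fintype V] {G : SimpleGraph V}
    (S : SecretSharingScheme G) {c : ℝ≥0∞} (h : ∀ v, S.ratio v ≤ c) : S.averageRatio ≤ c := by
  refine ENNReal.div_le_of_le_mul ?_
  refine (Finset.sum_le_card_nsmul _ _ _ fun v _ => h v).trans_eq ?_
  rw [nsmul_eq_mul, mul_comm, Finset.card_univ]

theorem spannedAverageRatio_le_of_ratio_le {V : Type} {G : SimpleGraph V}
    (S : SecretSharingScheme G) {c : ℝ≥0∞} (h : ∀ v, S.ratio v ≤ c) (W : Finset V) :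
    spannedAverageRatio G W ≤ c :=
  (iInf_le _ (S.restrict (W : Set V))).trans
    (averageRatio_le_of_ratio_le (S.restrict (W : Set V)) fun v => h v)

theorem spannedAverageRatio_le_informationRatio {V : Type} (G : SimpleGraph V) (W : Finset V) :
    spannedAverageRatio G W ≤ informationRatio G :=
  le_iInf fun S => spannedAverageRatio_le_of_ratio_le S (le_iSup S.ratio) W

theorem theorem2 (d : ℕ) (hd : 2 ≤ d) :
    informationRatio (latticeGraph d) = (d : ℝ≥0∞) ∧
    localAverageInformationRatio (latticeGraph d) = (d : ℝ≥0∞) ∧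
    Tendsto (fun k : ℕ => spannedAverageRatio (latticeGraph d) (latticeBox d k))
      atTop (𝓝 (d : ℝ≥0∞)) := by
  obtain ⟨S, hS⟩ := exists_scheme_ratio_le hd
  have hlim : Tendsto (fun k : ℕ => spannedAverageRatio (latticeGraph d) (latticeBox d k))
      atTop (𝓝 (d : ℝ≥0∞)) := by
    -- The box averages are squeezed between the edge count and the chessboard scheme. The remaining
    -- lower bounds follow, as both other ratios dominate these averages.
    refine tendsto_of_tendsto_of_tendsto_of_le_of_le' (tendsto_mul_sub_two_pow_div d)
      tendsto_const_nhds ?_ (Eventually.of_forall fun k => spannedAverageRatio_le_of_ratio_le S hS _)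
    filter_upwards [eventually_ge_atTop 2] with k hk
    exact le_spannedAverageRatio_latticeBox (by omega) hk
  refine ⟨le_antisymm ((iInf_le _ S).trans (iSup_le hS)) ?_, le_antisymm ?_ ?_, hlim⟩
  · exact le_of_tendsto hlim (Eventually.of_forall fun k =>
      spannedAverageRatio_le_informationRatio _ _)
  · exact iSup₂_le fun W _ => spannedAverageRatio_le_of_ratio_le S hS W
  · refine le_of_tendsto hlim ?_
    filter_upwards [eventually_ge_atTop 1] with k hk
    have hne : (latticeBox d k).Nonempty := by
      rw [← Finset.card_pos, card_latticeBox]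
      positivity
    exact le_iSup₂ (f := fun (W : Finset (Fin d → ℤ)) (_ : W.Nonempty) =>
      spannedAverageRatio (latticeGraph d) W) _ hne
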